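/- Let $N,m,p,T$ be nonnegative integers and $\tau>0$. Consider the game with state $x_t\in\mathbb R^m$, actions $u^i_t\in\mathbb R^p$ ($1\le i\le N$) and dynamics $$x_{t+1}=A_tx_t+\sum_{i=1}^N B^i_tu^i_t+\omega_t,\qquad 0\le t\le T-1,$$ where the noises $\omega_t\sim\mathcal N(0,\Sigma)$, $\Sigma\succeq0$, are independent of each other and of the past. Let $Q^i_t\succeq0$ and $R^i_t\succ0$ be symmetric, and let all priors be standard normal: $\mu^i_t(\cdot\mid x)=\mathcal N(0,I)$. An admissible policy of agent $i$ draws $u^i_t$ from a law depending measurably on $x_0,u^i_0,x_1,\dots,u^i_{t-1},x_t$; given the past, the agents randomize independently. A feedback policy is one of the form $u^i_t\sim\pi^i_t(\cdot\mid x_t)$. For $0\le s\le T$ the cost of agent $i$ in the game started at time $s$ in the state $x$ is $$J^i_s(x,\pi)=\mathbb E\Big[\sum_{t=s}^{T-1}\Big(x_t^\top Q^i_tx_t+(u^i_t)^\top R^i_tu^i_t+\tau\,D_{KL}(\pi^i_t\,\|\,\mu^i_t)\Big)+x_T^\top Q^i_Tx_T\,\Big|\,x_s=x\Big]\in[0,\infty],$$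 where $D_{KL}(\pi^i_t\|\mu^i_t)$ is the divergence of the conditional law of $u^i_t$ from the prior, that is, the conditional expectation of $\log(\pi^i_t/\mu^i_t)$. In the game started at time $s$ (where policies depend on the information since time $s$) a profile $\pi$ is a Nash equilibrium (NE) if for every $x\in\mathbb R^m$ and every $i$ the cost $J^i_s(x,\pi)$ is finite and agent $i$ cannot lower it by switching to any other admissible policy. A profile of feedback policies is a NE at all times if it is a NE of the game started at time $s$ for every $0\le s\le T$. For matrices $P^i_t\in\mathbb R^{m\times m}$ and $K^i_t\in\mathbb R^{p\times m}$ put $$A^i_t=A_t+\sum_{j\ne i}B^j_tK^j_t,\quad W^i_t=R^i_t+(B^i_t)^\top P^i_{t+1}B^i_t,\quad \Sigma^i_t=(I+2W^i_t/\tau)^{-1}.$$ The coupled Riccati equations at the time $t$ are, for all $i$, $$K^i_t=-\big(\tfrac\tau2I+W^i_t\big)^{-1}(B^i_t)^\top P^i_{t+1}A^i_t,$$ $$P^i_t=Q^i_t+(A^i_t)^\top P^i_{t+1}A^i_t-\big((B^i_t)^\top P^i_{t+1}A^i_t\big)^\top\big(\tfrac\tau2I+W^i_t\big)^{-1}\big((B^i_t)^\top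 P^i_{t+1}A^i_t\big),$$ with $P^i_T=Q^i_T$. The offsets are defined by $q^i_T=0$ and $$q^i_t=\mathrm{Tr}(\Sigma P^i_{t+1})+\mathrm{Tr}(W^i_t\Sigma^i_t)+\tfrac\tau2\big(\mathrm{Tr}(\Sigma^i_t)-p-\log|\Sigma^i_t|\big)+q^i_{t+1}+\mathrm{Tr}\Big(\sum_{j\ne i}\Sigma^j_t(B^j_t)^\top P^i_{t+1}B^j_t\Big).$$ Let $\Phi_t$ be the $N\times N$ block matrix with diagonal blocks $\frac\tau2I+W^i_t$ and off-diagonal blocks $(B^i_t)^\top P^i_{t+1}B^j_t$. Call the game nonsingular if for every $t<T$ and every solution $(P,K)$ of the coupled Riccati equations at the times $t+1,\dots,T-1$ (with $P^i_T=Q^i_T$) the matrix $\Phi_t$ is invertible. Theorem. 1. For every solution $(P,K)$ of the coupled Riccati equations at the times $0,\dots,T-1$, all $P^i_t$ ($t\le T$) are positive semidefinite, the feedback profile $\pi^i_t(\cdot\mid x)=\mathcal N(K^i_tx,\Sigma^i_t)$ is a NE at all times, and its values are $J^i_t(x,\pi)=x^\top P^i_tx+q^i_t$ for all $i$, $t\le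 T$ and $x$. 2. Let $\pi$ be a profile of feedback policies that is a NE at all times, and suppose that the game is nonsingular or that all means $\int u\,\pi^i_t(du\mid x)$ are linear in $x$. Then there is a solution $(P,K)$ of the coupled Riccati equations at the times $0,\dots,T-1$, with $P^i_t\succeq0$ and with offsets $q^i_t$, such that $\pi^i_t(\cdot\mid x)=\mathcal N(K^i_tx,\Sigma^i_t)$ for all $i$, $t<T$ and $x$, and $J^i_t(x,\pi)=x^\top P^i_tx+q^i_t$ for all $i$, $t\le T$ and $x$. 3. Let the game be nonsingular, and let $\pi$ be a profile of feedback policies that is a NE of the game started at time $0$, such that each $\pi^i_t(\cdot\mid x)$ gives positive probability to every set of positive Lebesgue measure. Then there is a solution $(P,K)$ as in 2 such that, for every initial state $x_0$ and every $t$, both formulas of 2 hold for all $i$ at almost every value $x$ of the state $x_t$ reached from $x_0$ under $\pi$ (in particular, at $t=0$, for every $x$). -/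

import Mathlib

open MeasureTheory ProbabilityTheory
open scoped ENNReal Matrix

noncomputable section

/-- The state space `ℝ^m`. -/
abbrev State (m : ℕ) := EuclideanSpace ℝ (Fin m)

/-- The action space `ℝ^p` of a single agent. -/
abbrev Control (p : ℕ) := EuclideanSpace ℝ (Fin p)

/-- The quadratic form `xᵀ M x`. -/
def quadForm {n : ℕ} (M : Matrix (Fin n) (Fin n) ℝ) (x : EuclideanSpace ℝ (Fin n)) : ℝ :=
  x.ofLp ⬝ᵥ (M *ᵥ x.ofLp)

/-- Histories `(x_0, u_0, x_1, …, u_{k-1}, x_k)` with states in `X` and actions in `U`. -/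
def Hist (X U : Type) : ℕ → Type
  | 0 => X
  | k + 1 => Hist X U k × (U × X)

namespace Hist

instance instMeasurableSpace {X U : Type} [MeasurableSpace X] [MeasurableSpace U] :
    (k : ℕ) → MeasurableSpace (Hist X U k)
  | 0 => inferInstanceAs (MeasurableSpace X)
  | k + 1 =>
    letI := instMeasurableSpace (X := X) (U := U) k
    inferInstanceAs (MeasurableSpace (Hist X U k × (U × X)))

/-- The current (last) state `x_k` of a history. -/
def cur {X U : Type} : {k : ℕ} → Hist X U k → X
  | 0, h => h
  | _ + 1, h => h.2.2

/-- Apply a map to all the actions of a history. -/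
def mapAct {X U V : Type} (f : U → V) : {k : ℕ} → Hist X U k → Hist X V k
  | 0, h => h
  | _ + 1, h => (mapAct f h.1, (f h.2.1, h.2.2))

/-- Agent `i`'s own part of a joint history: all the states, and the actions of agent `i`. -/
def own {N : ℕ} {X U : Type} (i : Fin N) {k : ℕ} (h : Hist X (Fin N → U) k) : Hist X U k :=
  h.mapAct (fun u : Fin N → U => u i)

theorem measurable_cur {X U : Type} [MeasurableSpace X] [MeasurableSpace U] :
    (k : ℕ) → Measurable (cur : Hist X U k → X)
  | 0 => measurable_id
  | k + 1 => (measurable_snd.comp measurable_snd :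
      Measurable (fun h : Hist X U k × (U × X) => h.2.2))

theorem measurable_mapAct {X U V : Type} [MeasurableSpace X] [MeasurableSpace U]
    [MeasurableSpace V] {f : U → V} (hf : Measurable f) :
    (k : ℕ) → Measurable (mapAct f : Hist X U k → Hist X V k)
  | 0 => measurable_id
  | k + 1 => (((measurable_mapAct hf k).comp measurable_fst).prodMk
      ((hf.comp (measurable_fst.comp measurable_snd)).prodMk
        (measurable_snd.comp measurable_snd)) :
      Measurable (fun h : Hist X U k × (U × X) =>
        ((mapAct f h.1, (f h.2.1, h.2.2)) : Hist X V k × (V × X))))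

theorem measurable_own {N : ℕ} {X U : Type} [MeasurableSpace X] [MeasurableSpace U] (i : Fin N)
    (k : ℕ) : Measurable (own i : Hist X (Fin N → U) k → Hist X U k) :=
  measurable_mapAct (measurable_pi_apply i) k

end Hist

/-- An admissible (randomized) policy of one agent. The conditional law of the action after `k`
steps depends measurably on the agent's own information `(x_0, u_0, x_1, …, u_{k-1}, x_k)`, that is
on the states and on this agent's own past actions. -/
structure Policy (m p : ℕ) where
  ker : (k : ℕ) → Kernel (Hist (State m) (Control p) k) (Control p)
  markov : ∀ k, IsMarkovKernel (ker k)

/-- A state-feedback policy `π_t(· | x_t)`. -/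
structure FeedbackPolicy (m p : ℕ) where
  ker : ℕ → Kernel (State m) (Control p)
  markov : ∀ t, IsMarkovKernel (ker t)

/-- The state-feedback policy `π`, used from time `s` on, as an admissible policy. -/
def FeedbackPolicy.lift {m p : ℕ} (π : FeedbackPolicy m p) (s : ℕ) : Policy m p where
  ker k := (π.ker (s + k)).comap Hist.cur (Hist.measurable_cur k)
  markov k := by
    have := π.markov (s + k)
    infer_instance

/-- A profile of state-feedback policies, used from time `s` on. -/
def liftProfile {N m p : ℕ} (π : Fin N → FeedbackPolicy m p) (s : ℕ) : Fin N → Policy m p :=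
  fun i => (π i).lift s

/-- An `N`-agent general-sum linear-quadratic game with relative-entropy regularization:
`x_{t+1} = A_t x_t + ∑ i, B^i_t u^i_t + ω_t` with i.i.d. noise `ω_t ∼ N(0, noiseCov)`, and stage
costs `xᵀ Q^i_t x + uᵀ R^i_t u + τ log (π^i_t(u | x) / μ^i_t(u | x))` with priors `μ^i_t`. -/
structure LQGame (N m p : ℕ) where
  T : ℕ
  A : ℕ → Matrix (Fin m) (Fin m) ℝ
  B : Fin N → ℕ → Matrix (Fin m) (Fin p) ℝ
  Q : Fin N → ℕ → Matrix (Fin m) (Fin m) ℝ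
  R : Fin N → ℕ → Matrix (Fin p) (Fin p) ℝ
  noiseCov : Matrix (Fin m) (Fin m) ℝ
  τ : ℝ
  prior : Fin N → ℕ → Kernel (State m) (Control p)
  Q_posSemidef : ∀ i t, t ≤ T → (Q i t).PosSemidef
  R_posDef : ∀ i t, t < T → (R i t).PosDef
  noiseCov_posSemidef : noiseCov.PosSemidef
  τ_pos : 0 < τ
  prior_markov : ∀ i t, IsMarkovKernel (prior i t)

/-- A product of Markov kernels depends measurably on the parameter. -/
theorem measurable_pi_kernel {N : ℕ} {X U : Type} [MeasurableSpace X] [MeasurableSpace U]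
    (κ : Fin N → Kernel X U) (hκ : ∀ i, IsMarkovKernel (κ i)) :
    Measurable (fun x => Measure.pi (fun i => κ i x)) := by
  refine Measurable.measure_of_isPiSystem_of_isProbabilityMeasure
    (S := Set.pi Set.univ '' Set.pi Set.univ fun _ : Fin N => {s : Set U | MeasurableSet s})
    generateFrom_pi.symm isPiSystem_pi ?_
  rintro _ ⟨s, hs, rfl⟩
  simp only [Measure.pi_pi]
  exact Finset.measurable_prod _ fun i _ => Kernel.measurable_coe (κ i) (hs i (Set.mem_univ i))

/-- Given the current history, the agents draw their actions independently. -/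
def jointAction {N m p : ℕ} (σ : Fin N → Policy m p) (k : ℕ) :
    Kernel (Hist (State m) (Fin N → Control p) k) (Fin N → Control p) where
  toFun h := Measure.pi fun i => (σ i).ker k (h.own i)
  measurable' := measurable_pi_kernel
    (fun i => ((σ i).ker k).comap (Hist.own i) (Hist.measurable_own i k))
    (fun i => by
      have := (σ i).markov k
      infer_instance)

instance {N m p : ℕ} (σ : Fin N → Policy m p) (k : ℕ) : IsMarkovKernel (jointAction σ k) :=
  ⟨fun h => by
    have := fun i => (σ i).markov k
    change IsProbabilityMeasure (Measure.pi fun i => (σ i).ker k (h.own i))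
    infer_instance⟩

/-- The kernel `x ↦ N(K x, S)`. -/
def gaussKernel {m p : ℕ} (K : Matrix (Fin p) (Fin m) ℝ) (S : Matrix (Fin p) (Fin p) ℝ) :
    Kernel (State m) (Control p) where
  toFun x := multivariateGaussian (K.toEuclideanLin x) S
  measurable' := by
    refine Measure.measurable_of_measurable_coe _ fun s hs => ?_
    have hf (L : Control p →L[ℝ] Control p) :
        Measurable fun z : State m × Control p => K.toEuclideanLin z.1 + L z.2 := by
      have h1 : Continuous fun x : State m => K.toEuclideanLin x :=
        LinearMap.continuous_of_finiteDimensional _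
      exact ((h1.comp continuous_fst).add (L.continuous.comp continuous_snd)).measurable
    have hg (L : Control p →L[ℝ] Control p) : Measurable fun x : State m =>
        (stdGaussian (Control p)).map (fun u => K.toEuclideanLin x + L u) s := by
      convert measurable_measure_prodMk_left (ν := stdGaussian (Control p)) (hf L hs) using 2 with x
      exact Measure.map_apply ((hf L).comp (measurable_prodMk_left (x := x))) hs
    exact hg _

namespace LQGame

variable {N m p : ℕ} (G : LQGame N m p)

/-- The noiseless next state `A_t x + ∑ i, B^i_t u^i`. -/
def drift (t : ℕ) (x : State m) (u : Fin N → Control p) : State m :=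
  (G.A t).toEuclideanLin x + ∑ i, (G.B i t).toEuclideanLin (u i)

/-- The law of the joint history of the first `k` steps, when the game starts at time `s` in the
state `x` and is played with the profile `σ` (step `k` takes place at time `s + k`). -/
def law (s : ℕ) (σ : Fin N → Policy m p) (x : State m) :
    (k : ℕ) → Measure (Hist (State m) (Fin N → Control p) k)
  | 0 => Measure.dirac x
  | k + 1 =>
    ((law s σ x k ⊗ₘ jointAction σ k).prod (multivariateGaussian 0 G.noiseCov)).map
      fun z => (z.1.1, (z.1.2, G.drift (s + k) z.1.1.cur z.1.2 + z.2))

theorem measurable_next (t k : ℕ) :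
    Measurable fun z : (Hist (State m) (Fin N → Control p) k × (Fin N → Control p)) × State m =>
      ((z.1.1, (z.1.2, G.drift t z.1.1.cur z.1.2 + z.2)) :
        Hist (State m) (Fin N → Control p) k × ((Fin N → Control p) × State m)) := by
  have h1 : Continuous fun x : State m => (G.A t).toEuclideanLin x :=
    LinearMap.continuous_of_finiteDimensional _
  have h2 : ∀ i, Continuous fun x : Control p => (G.B i t).toEuclideanLin x :=
    fun i => LinearMap.continuous_of_finiteDimensional _
  have hx := (Hist.measurable_cur (X := State m) (U := Fin N → Control p) k).comp
    (measurable_fst.comp (measurable_fst (β := State m)) : Measurable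
      fun z : (Hist (State m) (Fin N → Control p) k × (Fin N → Control p)) × State m => z.1.1)
  have hu : Measurable
      fun z : (Hist (State m) (Fin N → Control p) k × (Fin N → Control p)) × State m => z.1.2 :=
    measurable_snd.comp measurable_fst
  refine (measurable_fst.comp measurable_fst).prodMk (hu.prodMk ?_)
  refine Measurable.add (Measurable.add (h1.measurable.comp hx) ?_) measurable_snd
  exact Finset.measurable_sum _ fun i _ =>
    (h2 i).measurable.comp ((measurable_pi_apply i).comp hu)

/-- The laws of the histories are probability measures. -/
theorem isProbabilityMeasure_law (s : ℕ) (σ : Fin N → Policy m p) (x : State m) :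
    (k : ℕ) → IsProbabilityMeasure (G.law s σ x k)
  | 0 => by
    change IsProbabilityMeasure (Measure.dirac (α := State m) x)
    infer_instance
  | k + 1 => by
    have := isProbabilityMeasure_law s σ x k
    exact Measure.isProbabilityMeasure_map (G.measurable_next (s + k) k).aemeasurable

/-- The expected cost-to-go of agent `i` when the game starts at time `s` in the state `x` and is
played with the profile `σ`. The expectation of the logarithmic term, conditional on the history, is
the Kullback-Leibler divergence of the policy from the prior; so every summand has a well defined
expectation in `[0, ∞]`. -/
def cost (i : Fin N) (s : ℕ) (σ : Fin N → Policy m p) (x : State m) : ℝ≥0∞ :=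
  (∑ k ∈ Finset.range (G.T - s), ∫⁻ h : Hist (State m) (Fin N → Control p) (k + 1),
      (ENNReal.ofReal (quadForm (G.Q i (s + k)) h.1.cur)
        + ENNReal.ofReal (quadForm (G.R i (s + k)) (h.2.1 i))
        + ENNReal.ofReal G.τ *
          InformationTheory.klDiv ((σ i).ker k (h.1.own i))
            (G.prior i (s + k) h.1.cur))
      ∂(G.law s σ x (k + 1)))
    + ∫⁻ h, ENNReal.ofReal (quadForm (G.Q i G.T) h.cur) ∂(G.law s σ x (G.T - s))

/-- Nash equilibrium of the game started at time `s`: for every initial state, all agents have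
finite costs, and no agent can lower its cost by switching to another admissible policy. -/
def IsNash (s : ℕ) (σ : Fin N → Policy m p) : Prop :=
  ∀ (x : State m) (i : Fin N), G.cost i s σ x ≠ ∞ ∧
    ∀ ρ : Policy m p, G.cost i s σ x ≤ G.cost i s (Function.update σ i ρ) x

/-- `R^i_t + (B^i_t)ᵀ P^i_{t+1} B^i_t`. -/
def weight (P : Fin N → ℕ → Matrix (Fin m) (Fin m) ℝ) (i : Fin N) (t : ℕ) :
    Matrix (Fin p) (Fin p) ℝ :=
  G.R i t + (G.B i t)ᵀ * P i (t + 1) * G.B i t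

/-- `(τ/2) I + R^i_t + (B^i_t)ᵀ P^i_{t+1} B^i_t`. -/
def regWeight (P : Fin N → ℕ → Matrix (Fin m) (Fin m) ℝ) (i : Fin N) (t : ℕ) :
    Matrix (Fin p) (Fin p) ℝ :=
  (G.τ / 2) • (1 : Matrix (Fin p) (Fin p) ℝ) + G.weight P i t

/-- `A^i_t = A_t + ∑ j ≠ i, B^j_t K^j_t`. -/
def othersA (K : Fin N → ℕ → Matrix (Fin p) (Fin m) ℝ) (i : Fin N) (t : ℕ) :
    Matrix (Fin m) (Fin m) ℝ :=
  G.A t + ∑ j ∈ Finset.univ.erase i, G.B j t * K j t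

/-- The covariance `Σ^i_t = (I + 2 (R^i_t + (B^i_t)ᵀ P^i_{t+1} B^i_t) / τ)⁻¹`. -/
def nashCov (P : Fin N → ℕ → Matrix (Fin m) (Fin m) ℝ) (i : Fin N) (t : ℕ) :
    Matrix (Fin p) (Fin p) ℝ :=
  (1 + (2 / G.τ) • G.weight P i t)⁻¹

/-- The matrices `P` and the gains `K` solve the coupled Riccati equations at the times
`s ≤ t < T`, with terminal condition `P^i_T = Q^i_T`. -/
structure IsRiccatiFrom (s : ℕ) (P : Fin N → ℕ → Matrix (Fin m) (Fin m) ℝ)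
    (K : Fin N → ℕ → Matrix (Fin p) (Fin m) ℝ) : Prop where
  terminal : ∀ i, P i G.T = G.Q i G.T
  gain : ∀ i t, s ≤ t → t < G.T →
    K i t = -((G.regWeight P i t)⁻¹ * ((G.B i t)ᵀ * P i (t + 1) * G.othersA K i t))
  riccati : ∀ i t, s ≤ t → t < G.T →
    P i t = G.Q i t + (G.othersA K i t)ᵀ * P i (t + 1) * G.othersA K i t
      - ((G.B i t)ᵀ * P i (t + 1) * G.othersA K i t)ᵀ * (G.regWeight P i t)⁻¹
        * ((G.B i t)ᵀ * P i (t + 1) * G.othersA K i t)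

/-- The recursion for the constant terms `q^i_t` of the values. -/
structure IsOffset (P : Fin N → ℕ → Matrix (Fin m) (Fin m) ℝ) (q : Fin N → ℕ → ℝ) : Prop where
  terminal : ∀ i, q i G.T = 0
  step : ∀ i t, t < G.T →
    q i t = (G.noiseCov * P i (t + 1)).trace
      + (G.weight P i t * G.nashCov P i t).trace
      + G.τ / 2 * ((G.nashCov P i t).trace - p - Real.log (G.nashCov P i t).det)
      + q i (t + 1)
      + (∑ j ∈ Finset.univ.erase i,
          G.nashCov P j t * (G.B j t)ᵀ * P i (t + 1) * G.B j t).trace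

/-- The linear Gaussian policy `N(K^i_t x, Σ^i_t)` of agent `i`. -/
def gaussPolicy (P : Fin N → ℕ → Matrix (Fin m) (Fin m) ℝ)
    (K : Fin N → ℕ → Matrix (Fin p) (Fin m) ℝ) (i : Fin N) : FeedbackPolicy m p where
  ker t := gaussKernel (K i t) (G.nashCov P i t)
  markov t := ⟨fun x => by
    change IsProbabilityMeasure (multivariateGaussian _ _)
    infer_instance⟩

/-- At time `t` in the state `x`, each agent's value under the profile `π` is finite and equals
`xᵀ P^i_t x + q^i_t`. -/
def HasQuadValue (P : Fin N → ℕ → Matrix (Fin m) (Fin m) ℝ) (q : Fin N → ℕ → ℝ)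
    (π : Fin N → FeedbackPolicy m p) (t : ℕ) (x : State m) : Prop :=
  ∀ i, G.cost i t (liftProfile π t) x ≠ ∞ ∧
    (G.cost i t (liftProfile π t) x).toReal = quadForm (P i t) x + q i t

/-- At time `t` in the state `x`, each agent's action is drawn from `N(K^i_t x, Σ^i_t)`. -/
def IsLinGaussAt (P : Fin N → ℕ → Matrix (Fin m) (Fin m) ℝ)
    (K : Fin N → ℕ → Matrix (Fin p) (Fin m) ℝ)
    (π : Fin N → FeedbackPolicy m p) (t : ℕ) (x : State m) : Prop :=
  ∀ i, (π i).ker t x = multivariateGaussian ((K i t).toEuclideanLin x) (G.nashCov P i t)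

/-- The block matrix `Φ_t` of the linear system for the gains `(K^1_t, …, K^N_t)`: its diagonal
blocks are `(τ/2) I + R^i_t + (B^i_t)ᵀ P^i_{t+1} B^i_t`, its off-diagonal blocks are
`(B^i_t)ᵀ P^i_{t+1} B^j_t`. -/
def gainMatrix (P : Fin N → ℕ → Matrix (Fin m) (Fin m) ℝ) (t : ℕ) :
    Matrix (Fin N × Fin p) (Fin N × Fin p) ℝ :=
  fun a b =>
    if a.1 = b.1 then G.regWeight P a.1 t a.2 b.2
    else ((G.B a.1 t)ᵀ * P a.1 (t + 1) * G.B b.1 t) a.2 b.2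

/-- Along the backward recursion, the linear system for the gains is nonsingular at each time. -/
def IsNonsingular : Prop :=
  ∀ t, t < G.T → ∀ P K, G.IsRiccatiFrom (t + 1) P K → IsUnit (G.gainMatrix P t).det

/-- The mean action of each agent is a linear function of the state, at each time. -/
def HasLinearMeans (π : Fin N → FeedbackPolicy m p) : Prop :=
  ∀ i t, t < G.T → ∃ L : Matrix (Fin p) (Fin m) ℝ,
    ∀ x, ∫ u, u ∂((π i).ker t x) = L.toEuclideanLin x

end LQGame

end

/-!
The proof is dynamic programming, one time step at a time, with the Gibbs variational principle in
place of the pointwise minimization.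

Suppose that from time `t + 1` on the cost of agent `i` is `yᵀ P y + q` with `P ⪰ 0`, and that the
other agents' action laws at time `t` are fixed. As a function of the law `μ` of agent `i`'s action,
the cost at time `t` is `τ D_KL(μ ‖ N(0, I))` plus the `μ`-expectation of a quadratic function of
the action, with Hessian `2 W` for `W = R + Bᵀ P B`; this uses that agent `i`'s action is
independent of the rest of the next state (`lintegral_next_update`). Exponentially tilting the
standard normal law by such a quadratic function gives a Gaussian with covariance `(I + 2 W / τ)⁻¹`
(`stdGaussian_tilted`), so by the Gibbs principle (`quadratic_gibbs`) the cost of `μ` is the minimal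
cost plus `τ` times the divergence of `μ` from that Gaussian (`stage_add_next_eq_klDiv`). The best
response is therefore unique and Gaussian, and only its mean depends on the other agents' laws.

If all agents play `N(K x, Σ)`, the minimal cost is quadratic in `x`, with coefficients given by the
Riccati equation and by the recursion for the offsets (`minCost_of_gaussian`), and the gain equation
says that `N(K^i x, Σ^i)` is the best response. Hence solutions of the coupled Riccati equations are
equilibria: a backward induction gives their costs (`cost_gaussPolicy`), and a telescoping sum over
the steps covers deviations to arbitrary history-dependent policies (`isNash_gaussPolicy`).

Conversely, at an equilibrium consider the deviation that plays the best response at a single time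
`t`. It never costs more, so it must cost the same, and then the divergence above vanishes at almost
every reached state: the agents play mutual best responses (`IsNash.ae_eq_bestResponse`). Their
means solve a linear system with the matrix `gainMatrix`. If this matrix is invertible, or if the
means are assumed to be linear, the means are `K x` with gains solving the gain equations, and the
cost at time `t` is again quadratic. For an equilibrium at all times and states this closes the
backward induction (`isRiccatiFrom_of_isNash`). For an equilibrium of the game started at time zero
the continuation cost is known only outside a null set of the reached states; as the policies
charge all sets of positive Lebesgue measure, a deviation with a Lebesgue density does not charge
this null set, and the same induction works almost everywhere (`ae_isLinGaussAt_of_isNash`).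

The cost of an agent is finite at an equilibrium, but the other agents' actions need not be
integrable. What finiteness gives is that `P^{1/2}` applied to the other agents' contribution to the
next state is square integrable (`memLp_rest_of_ne_top`), and this is all that the expansion of the
square requires.
-/

/-! ### Gaussian measures as exponential tilts -/

/-- The Lebesgue density of the standard Gaussian measure. -/
theorem stdGaussian_eq_withDensity (p : ℕ) :
    stdGaussian (Control p) = (volume : Measure (Control p)).withDensity
      (fun v => ENNReal.ofReal
        ((Real.sqrt (2 * Real.pi))⁻¹ ^ p * Real.exp (-(v.ofLp ⬝ᵥ v.ofLp) / 2))) := by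
  have hpi : (Measure.pi (fun _ : Fin p => gaussianReal 0 1)) =
      (volume : Measure (Fin p → ℝ)).withDensity
        (fun v => ENNReal.ofReal (∏ i, gaussianPDFReal 0 1 (v i))) := by
    refine Measure.pi_eq fun s hs => ?_
    rw [withDensity_apply _ (MeasurableSet.univ_pi hs), volume_pi, Measure.restrict_pi_pi,
      ← ofReal_integral_eq_lintegral_ofReal
        (Integrable.fintype_prod fun i => (integrable_gaussianPDFReal 0 1).restrict)
        (ae_of_all _ fun v => Finset.prod_nonneg fun i _ => gaussianPDFReal_nonneg _ _ _),
      integral_fintype_prod_eq_prod,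
      ENNReal.ofReal_prod_of_nonneg
        (fun i _ => integral_nonneg fun v => gaussianPDFReal_nonneg _ _ _)]
    exact Finset.prod_congr rfl fun i _ =>
      (gaussianReal_apply_eq_integral 0 one_ne_zero (s i)).symm
  rw [← map_pi_eq_stdGaussian, hpi]
  ext s hs
  have hms := PiLp.volume_preserving_toLp (Fin p)
  rw [Measure.map_apply (by fun_prop) hs, withDensity_apply _ (hms.measurable hs),
    withDensity_apply _ hs, ← hms.setLIntegral_comp_preimage hs (by fun_prop)]
  refine lintegral_congr fun v => ?_
  simp [gaussianPDFReal_def, Finset.prod_mul_distrib, ← Real.exp_sum, dotProduct, pow_two,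
    ← Finset.sum_div]

theorem stdGaussian_absolutelyContinuous (p : ℕ) :
    stdGaussian (Control p) ≪ (volume : Measure (Control p)) := by
  rw [stdGaussian_eq_withDensity]
  exact withDensity_absolutelyContinuous _ _

theorem Matrix.PosSemidef.one_add_posDef {p : ℕ} {W : Matrix (Fin p) (Fin p) ℝ}
    (hW : W.PosSemidef) : (1 + W).PosDef :=
  Matrix.PosDef.one.add_posSemidef hW

theorem Matrix.PosSemidef.transpose_eq_self {n : ℕ} {M : Matrix (Fin n) (Fin n) ℝ}
    (hM : M.PosSemidef) : Mᵀ = M :=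
  (Matrix.conjTranspose_eq_transpose_of_trivial M).symm.trans hM.isHermitian

/-- The exponent `-(vᵀ W v) / 2 - bᵀ v` of a Gaussian tilt. -/
noncomputable def tiltExponent {p : ℕ} (W : Matrix (Fin p) (Fin p) ℝ) (b : Fin p → ℝ)
    (v : Control p) : ℝ :=
  -(quadForm W v) / 2 - b ⬝ᵥ v.ofLp

theorem continuous_quadForm {n : ℕ} (M : Matrix (Fin n) (Fin n) ℝ) : Continuous (quadForm M) := by
  unfold quadForm Matrix.mulVec dotProduct
  fun_prop

theorem continuous_tiltExponent {p : ℕ} (W : Matrix (Fin p) (Fin p) ℝ) (b : Fin p → ℝ) :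
    Continuous (tiltExponent W b) := by
  have := continuous_quadForm W
  unfold tiltExponent dotProduct
  fun_prop

open scoped MatrixOrder Matrix.Norms.L2Operator in
/-- The Gaussian density relative to the standard Gaussian measure is obtained by the affine
change of variables `v ↦ h + S v`, where `S` is the square root of the covariance. -/
theorem multivariateGaussian_eq_withDensity {p : ℕ} {W : Matrix (Fin p) (Fin p) ℝ}
    (hW : W.PosSemidef) (b : Fin p → ℝ) :
    ∃ c : ℝ, 0 < c ∧
      Real.log c = Real.log (1 + W).det / 2 - (b ⬝ᵥ ((1 + W)⁻¹ *ᵥ b)) / 2 ∧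
      multivariateGaussian (WithLp.toLp 2 (-((1 + W)⁻¹ *ᵥ b))) (1 + W)⁻¹ =
        (stdGaussian (Control p)).withDensity
          (fun v => ENNReal.ofReal (c * Real.exp (tiltExponent W b v))) := by
  have hM := Matrix.PosSemidef.one_add_posDef hW
  have hMdet : IsUnit (1 + W).det := hM.det_pos.ne'.isUnit
  have hSig : ((1 + W)⁻¹).PosDef := hM.inv
  set M := 1 + W with hMdef
  set h : Control p := WithLp.toLp 2 (-(M⁻¹ *ᵥ b)) with hh
  set S := CFC.sqrt (M⁻¹) with hS
  have hSS : S * S = M⁻¹ := CFC.sqrt_mul_sqrt_self _ hSig.posSemidef.nonneg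
  have hSdet2 : S.det * S.det = (M.det)⁻¹ := by
    rw [← Matrix.det_mul, hSS, Matrix.det_nonsing_inv, Ring.inverse_eq_inv']
  have hSdet : S.det ≠ 0 := by
    intro h0
    rw [h0, mul_zero] at hSdet2
    exact (inv_pos.2 hM.det_pos).ne hSdet2
  have hSsymm : Sᵀ = S := by
    have : S.IsHermitian := (CFC.sqrt_nonneg (M⁻¹)).isSelfAdjoint
    exact (Matrix.conjTranspose_eq_transpose_of_trivial S).symm.trans this
  have hSMS : Sᵀ * M * S = 1 := by
    have h1 : S * (S * M) = 1 := by
      rw [← mul_assoc, hSS, Matrix.nonsing_inv_mul _ hMdet]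
    rw [hSsymm]
    exact mul_eq_one_comm.1 h1
  have hMsymm : Mᵀ = M := hM.posSemidef.transpose_eq_self
  have hMh : M *ᵥ h.ofLp = -b := by
    simp [hh, Matrix.mulVec_neg, Matrix.mulVec_mulVec, Matrix.mul_nonsing_inv _ hMdet]
  have hhMh : h.ofLp ⬝ᵥ (M *ᵥ h.ofLp) = b ⬝ᵥ (M⁻¹ *ᵥ b) := by
    rw [hMh]; simp [hh, dotProduct_comm]
  -- the quadratic exponents agree along the change of variables
  have hexp (v : Control p) (w : Fin p → ℝ) (hw : w = h.ofLp + S *ᵥ v.ofLp) :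
      -(v.ofLp ⬝ᵥ v.ofLp) / 2 = -(w ⬝ᵥ w) / 2 +
        (-(w ⬝ᵥ (W *ᵥ w)) / 2 - b ⬝ᵥ w) - (b ⬝ᵥ (M⁻¹ *ᵥ b)) / 2 := by
    have e1 : v.ofLp ⬝ᵥ v.ofLp = (w - h.ofLp) ⬝ᵥ (M *ᵥ (w - h.ofLp)) := by
      have : w - h.ofLp = S *ᵥ v.ofLp := by rw [hw]; simp
      rw [this, Matrix.mulVec_mulVec, Matrix.dotProduct_mulVec, ← Matrix.vecMul_transpose,
        Matrix.vecMul_vecMul, ← mul_assoc, hSMS, Matrix.vecMul_one]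
    have e2 : h.ofLp ⬝ᵥ (M *ᵥ w) = -(b ⬝ᵥ w) := by
      rw [Matrix.dotProduct_mulVec, ← Matrix.mulVec_transpose, hMsymm, hMh, neg_dotProduct]
    have e3 : w ⬝ᵥ (M *ᵥ w) = w ⬝ᵥ w + w ⬝ᵥ (W *ᵥ w) := by
      rw [hMdef, Matrix.add_mulVec, Matrix.one_mulVec, dotProduct_add]
    rw [e1, Matrix.mulVec_sub, sub_dotProduct, dotProduct_sub, dotProduct_sub, e2, e3, hhMh, hMh,
      dotProduct_neg, dotProduct_comm w b]
    ring
  refine ⟨|S.det|⁻¹ * Real.exp (-(b ⬝ᵥ (M⁻¹ *ᵥ b)) / 2), by positivity, ?_, ?_⟩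
  · rw [Real.log_mul (by positivity) (Real.exp_ne_zero _), Real.log_exp, Real.log_inv,
      Real.log_abs]
    have : Real.log M.det = -(2 * Real.log S.det) := by
      rw [two_mul, ← Real.log_mul hSdet hSdet, hSdet2, Real.log_inv, neg_neg]
    rw [this]; ring
  · set r := (Real.sqrt (2 * Real.pi))⁻¹ ^ p with hr
    have hr0 : 0 ≤ r := by positivity
    have hcont := continuous_tiltExponent W b
    have hlin : (fun x : Control p => h + Matrix.toEuclideanCLM (𝕜 := ℝ) S x)
        = fun x => h + S.toEuclideanLin x := rfl
    have hLcont : Continuous fun x : Control p => S.toEuclideanLin x :=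
      LinearMap.continuous_of_finiteDimensional _
    have hmeas : Measurable fun x : Control p => h + S.toEuclideanLin x :=
      (hLcont.measurable).const_add h
    have hdetL : LinearMap.det (S.toEuclideanLin) = S.det := by
      rw [Matrix.toEuclideanLin, Matrix.toLpLin_eq_toLin, LinearMap.det_toLin]
    have hρ : Measurable fun v : Control p =>
        ENNReal.ofReal (r * Real.exp (-(v.ofLp ⬝ᵥ v.ofLp) / 2)) := by
      unfold dotProduct; fun_prop
    ext s hs
    rw [multivariateGaussian, ← hS, hlin, Measure.map_apply hmeas hs, stdGaussian_eq_withDensity,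
      withDensity_apply _ (hmeas hs), ← withDensity_mul _ hρ (by fun_prop),
      withDensity_apply _ hs, ← lintegral_indicator (hmeas hs), ← lintegral_indicator hs]
    set F : Control p → ℝ≥0∞ := fun w => s.indicator (fun w => ENNReal.ofReal (r *
      Real.exp (-(w.ofLp ⬝ᵥ w.ofLp) / 2) * (Real.exp (-(b ⬝ᵥ (M⁻¹ *ᵥ b)) / 2) *
        Real.exp (tiltExponent W b w)))) w with hF
    have hFm : Measurable F := by
      refine Measurable.indicator ?_ hs
      unfold dotProduct at hρ ⊢
      fun_prop
    have hstep : ∀ v : Control p, ((fun x => h + S.toEuclideanLin x) ⁻¹' s).indicator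
        (fun v : Control p => ENNReal.ofReal (r * Real.exp (-(v.ofLp ⬝ᵥ v.ofLp) / 2))) v =
        F (h + S.toEuclideanLin v) := by
      intro v
      simp only [hF, Set.indicator, Set.mem_preimage]
      congr 1
      rw [← Real.exp_add, mul_assoc, ← Real.exp_add]
      congr 3
      rw [hexp v _ rfl, tiltExponent, quadForm]
      simp only [WithLp.ofLp_add, Matrix.ofLp_toLpLin, Matrix.toLin'_apply]
      ring
    rw [lintegral_congr hstep]
    have hvol := Measure.map_linearMap_addHaar_eq_smul_addHaar (volume : Measure (Control p))
      (f := S.toEuclideanLin) (by rwa [hdetL])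
    calc ∫⁻ v : Control p, F (h + S.toEuclideanLin v)
        = ∫⁻ w, F (h + w) ∂(Measure.map (S.toEuclideanLin) (volume : Measure (Control p))) :=
          (lintegral_map (hFm.comp (measurable_const_add h)) hLcont.measurable).symm
      _ = ENNReal.ofReal |S.det|⁻¹ * ∫⁻ w, F (h + w) := by
          rw [hvol, lintegral_smul_measure, hdetL, abs_inv, smul_eq_mul]
      _ = ENNReal.ofReal |S.det|⁻¹ * ∫⁻ w, F w := by rw [lintegral_add_left_eq_self]
      _ = _ := by
          rw [← lintegral_const_mul _ hFm]
          refine lintegral_congr fun w => ?_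
          simp only [hF, Set.indicator, Pi.mul_apply]
          split_ifs with hw
          · rw [← ENNReal.ofReal_mul (by positivity), ← ENNReal.ofReal_mul (by positivity)]
            congr 1
            ring
          · simp

/-- The Gaussian `N(-(I + W)⁻¹ b, (I + W)⁻¹)` is an exponential tilt of the standard one. -/
theorem stdGaussian_tilted {p : ℕ} {W : Matrix (Fin p) (Fin p) ℝ} (hW : W.PosSemidef)
    (b : Fin p → ℝ) :
    Integrable (fun v => Real.exp (tiltExponent W b v)) (stdGaussian (Control p)) ∧
    (stdGaussian (Control p)).tilted (tiltExponent W b) =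
      multivariateGaussian (WithLp.toLp 2 (-((1 + W)⁻¹ *ᵥ b))) (1 + W)⁻¹ ∧
    Real.log (∫ v, Real.exp (tiltExponent W b v) ∂(stdGaussian (Control p))) =
      (b ⬝ᵥ ((1 + W)⁻¹ *ᵥ b)) / 2 - Real.log (1 + W).det / 2 := by
  obtain ⟨c, hc, hlog, hN⟩ := multivariateGaussian_eq_withDensity hW b
  have hcont := continuous_tiltExponent W b
  have huniv : ∫⁻ v, ENNReal.ofReal (c * Real.exp (tiltExponent W b v))
      ∂(stdGaussian (Control p)) = 1 := by
    rw [← setLIntegral_univ, ← withDensity_apply _ MeasurableSet.univ, ← hN, measure_univ]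
  have hint : Integrable (fun v => c * Real.exp (tiltExponent W b v))
      (stdGaussian (Control p)) := by
    refine ⟨by fun_prop, ?_⟩
    rw [hasFiniteIntegral_iff_ofReal (ae_of_all _ fun v => by positivity), huniv]
    exact ENNReal.one_lt_top
  have hval : ∫ v, c * Real.exp (tiltExponent W b v) ∂(stdGaussian (Control p)) = 1 := by
    rw [integral_eq_lintegral_of_nonneg_ae (ae_of_all _ fun v => by positivity) (by fun_prop),
      huniv, ENNReal.toReal_one]
  rw [integral_const_mul] at hval
  have hZ : ∫ v, Real.exp (tiltExponent W b v) ∂(stdGaussian (Control p)) = c⁻¹ :=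
    eq_inv_of_mul_eq_one_right hval
  refine ⟨(integrable_const_mul_iff hc.ne'.isUnit _).1 hint, ?_, ?_⟩
  · rw [hN, Measure.tilted, hZ]
    simp [mul_comm]
  · rw [hZ, Real.log_inv, hlog]; ring

/-- For `W ⪰ 0` the normalizing constant shows `log det (I + W) ≥ 0`. -/
theorem log_det_one_add_nonneg {p : ℕ} {W : Matrix (Fin p) (Fin p) ℝ} (hW : W.PosSemidef) :
    0 ≤ Real.log (1 + W).det := by
  obtain ⟨hint, -, hlog⟩ := stdGaussian_tilted hW 0
  have hle : ∫ v, Real.exp (tiltExponent W 0 v) ∂(stdGaussian (Control p)) ≤ 1 := by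
    calc _ ≤ ∫ v, (1 : ℝ) ∂(stdGaussian (Control p)) := by
          refine integral_mono hint (integrable_const _) fun v => ?_
          refine Real.exp_le_one_iff.2 ?_
          have := hW.dotProduct_mulVec_nonneg v.ofLp
          simp only [star_trivial] at this
          simp only [tiltExponent, quadForm, zero_dotProduct]
          linarith
      _ = 1 := by simp
  have h0 := Real.log_nonpos (integral_nonneg fun v => (Real.exp_pos _).le) hle
  rw [hlog] at h0
  simp only [zero_dotProduct] at h0
  linarith

theorem multivariateGaussian_absolutelyContinuous {p : ℕ} {W : Matrix (Fin p) (Fin p) ℝ}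
    (hW : W.PosSemidef) (h : Control p) :
    multivariateGaussian h (1 + W)⁻¹ ≪ (volume : Measure (Control p)) := by
  have hdet : IsUnit (1 + W).det := (Matrix.PosSemidef.one_add_posDef hW).det_pos.ne'.isUnit
  obtain ⟨-, h2, -⟩ := stdGaussian_tilted hW (-((1 + W) *ᵥ h.ofLp))
  rw [Matrix.mulVec_neg, neg_neg, Matrix.mulVec_mulVec, Matrix.nonsing_inv_mul _ hdet,
    Matrix.one_mulVec] at h2
  exact h2 ▸ (tilted_absolutelyContinuous _ _).trans (stdGaussian_absolutelyContinuous p)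

/-! ### The Gibbs variational principle -/

open InformationTheory in
/-- The Gibbs variational identity, for an energy `f = c - τ g ≥ 0`: the free energy of `μ` exceeds
that of the tilted measure by `τ` times the divergence of `μ` from it. -/
theorem gibbs_variational {α : Type*} [MeasurableSpace α] {μ γ : Measure α}
    [IsProbabilityMeasure μ] [IsProbabilityMeasure γ] {τ c : ℝ} (hτ : 0 < τ) {g : α → ℝ}
    (hgm : Measurable g) (hg : Integrable (fun x => Real.exp (g x)) γ)
    (hf : ∀ x, 0 ≤ c - τ * g x)
    (hfin : ENNReal.ofReal τ * klDiv μ γ + ∫⁻ x, ENNReal.ofReal (c - τ * g x) ∂μ ≠ ∞) :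
    ENNReal.ofReal τ * klDiv μ γ + ∫⁻ x, ENNReal.ofReal (c - τ * g x) ∂μ =
      ENNReal.ofReal τ * klDiv μ (γ.tilted g)
        + ENNReal.ofReal (c - τ * Real.log (∫ x, Real.exp (g x) ∂γ)) := by
  have hkl : klDiv μ γ ≠ ∞ := by
    intro h
    rw [h, ENNReal.mul_top (by simpa using hτ), top_add] at hfin
    exact hfin rfl
  have hfi : Integrable (fun x => c - τ * g x) μ := by
    refine ⟨by fun_prop, ?_⟩
    rw [hasFiniteIntegral_iff_ofReal (ae_of_all _ hf)]
    exact (ENNReal.add_ne_top.1 hfin).2.lt_top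
  have hgi : Integrable g μ := by
    have h1 : Integrable (fun x => τ⁻¹ * (c - (c - τ * g x))) μ :=
      ((integrable_const c).sub hfi).const_mul _
    refine h1.congr (ae_of_all _ fun x => ?_)
    field_simp
    ring
  obtain ⟨hac, hllr⟩ := klDiv_ne_top_iff.1 hkl
  have hacT : μ ≪ γ.tilted g := hac.trans (absolutelyContinuous_tilted hg)
  have hllrT := integrable_llr_tilted_right hac hgi hllr hg
  have : IsProbabilityMeasure (γ.tilted g) := isProbabilityMeasure_tilted hg
  have h1 := toReal_klDiv_of_measure_eq hac (by simp)
  have h2 := toReal_klDiv_of_measure_eq hacT (by simp)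
  rw [integral_llr_tilted_right hac hgi hg hllr, ← h1] at h2
  have hklT : klDiv μ (γ.tilted g) ≠ ∞ := klDiv_ne_top hacT hllrT
  have hZpos : 0 < ∫ x, Real.exp (g x) ∂γ := integral_exp_pos hg
  have hC : 0 ≤ c - τ * Real.log (∫ x, Real.exp (g x) ∂γ) := by
    have hle : ∫ x, Real.exp (g x) ∂γ ≤ Real.exp (c / τ) := by
      calc _ ≤ ∫ x, Real.exp (c / τ) ∂γ := by
            refine integral_mono hg (integrable_const _) fun x => Real.exp_le_exp.2 ?_
            rw [le_div_iff₀ hτ]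
            linarith [hf x]
        _ = _ := by simp
    have := (Real.log_le_iff_le_exp hZpos).2 hle
    rw [le_div_iff₀ hτ] at this
    linarith
  rw [← ofReal_integral_eq_lintegral_ofReal hfi (ae_of_all _ hf), ← ENNReal.ofReal_toReal hkl,
    ← ENNReal.ofReal_toReal hklT, ← ENNReal.ofReal_mul hτ.le, ← ENNReal.ofReal_mul hτ.le,
    ← ENNReal.ofReal_add (by positivity) (integral_nonneg hf),
    ← ENNReal.ofReal_add (by positivity) hC, h2,
    integral_sub (integrable_const _) (hgi.const_mul _), integral_const_mul]
  congr 1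
  simp
  ring

open InformationTheory in
/-- The tilted measure has finite free energy. -/
theorem free_energy_tilted_ne_top {α : Type*} [MeasurableSpace α] {γ : Measure α}
    [IsProbabilityMeasure γ] {τ c : ℝ} {g : α → ℝ}
    (hg : Integrable (fun x => Real.exp (g x)) γ)
    (hf : ∀ x, 0 ≤ c - τ * g x) (hgi : Integrable g (γ.tilted g)) :
    ENNReal.ofReal τ * klDiv (γ.tilted g) γ
      + ∫⁻ x, ENNReal.ofReal (c - τ * g x) ∂(γ.tilted g) ≠ ∞ := by
  have : IsProbabilityMeasure (γ.tilted g) := isProbabilityMeasure_tilted hg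
  have hac := tilted_absolutelyContinuous γ g
  refine ENNReal.add_ne_top.2 ⟨ENNReal.mul_ne_top ENNReal.ofReal_ne_top (klDiv_ne_top hac ?_), ?_⟩
  · refine (hgi.sub (integrable_const (Real.log (∫ x, Real.exp (g x) ∂γ)))).congr ?_
    filter_upwards [hac.ae_le (log_rnDeriv_tilted_left_self hg)] with x hx
    exact hx.symm
  · have hfi : Integrable (fun x => c - τ * g x) (γ.tilted g) :=
      (integrable_const _).sub (hgi.const_mul _)
    exact (hasFiniteIntegral_iff_ofReal (ae_of_all _ hf)).1 hfi.2 |>.ne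

theorem quadForm_smul {n : ℕ} (c : ℝ) (M : Matrix (Fin n) (Fin n) ℝ)
    (x : EuclideanSpace ℝ (Fin n)) : quadForm (c • M) x = c * quadForm M x := by
  simp [quadForm, Matrix.smul_mulVec]

theorem integrable_quadForm {n : ℕ} (M : Matrix (Fin n) (Fin n) ℝ)
    (μ : Measure (EuclideanSpace ℝ (Fin n))) (hμ : MemLp id 2 μ) :
    Integrable (quadForm M) μ := by
  have hi (i : Fin n) : MemLp (fun x : EuclideanSpace ℝ (Fin n) => x i) 2 μ :=
    hμ.continuousLinearMap_comp (EuclideanSpace.proj i : EuclideanSpace ℝ (Fin n) →L[ℝ] ℝ)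
  have : quadForm M = fun x => ∑ i, ∑ j, M i j * (x i * x j) := by
    ext x
    simp only [quadForm, dotProduct, Matrix.mulVec, Finset.mul_sum]
    exact Finset.sum_congr rfl fun i _ => Finset.sum_congr rfl fun j _ => by ring
  rw [this]
  exact integrable_finsetSum _ fun i _ => integrable_finsetSum _ fun j _ =>
    ((hi i).integrable_mul (hi j)).const_mul _

theorem integrable_tiltExponent {p : ℕ} (W : Matrix (Fin p) (Fin p) ℝ) (b : Fin p → ℝ)
    (μ : Measure (Control p)) [IsFiniteMeasure μ] (hμ : MemLp id 2 μ) :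
    Integrable (tiltExponent W b) μ := by
  have hi (i : Fin p) : MemLp (fun x : EuclideanSpace ℝ (Fin p) => x i) 2 μ :=
    hμ.continuousLinearMap_comp (EuclideanSpace.proj i : EuclideanSpace ℝ (Fin p) →L[ℝ] ℝ)
  refine ((integrable_quadForm W μ hμ).neg.div_const 2).sub ?_
  exact integrable_finsetSum _ fun i _ => ((hi i).integrable (by norm_num)).const_mul _

open InformationTheory in
/-- The Gibbs principle for a quadratic energy and the standard normal prior: the minimizer is the
Gaussian with mean `-(τ/2 I + W)⁻¹ b` and covariance `(I + 2W/τ)⁻¹`. -/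
theorem quadratic_gibbs {p : ℕ} {τ c : ℝ} (hτ : 0 < τ) {W : Matrix (Fin p) (Fin p) ℝ}
    (hW : W.PosSemidef) (b : Fin p → ℝ) (hf : ∀ v, 0 ≤ quadForm W v + 2 * (b ⬝ᵥ v.ofLp) + c) :
    letI N := multivariateGaussian
      (WithLp.toLp 2 (-(((τ / 2) • (1 : Matrix (Fin p) (Fin p) ℝ) + W)⁻¹ *ᵥ b)))
      (1 + (2 / τ) • W)⁻¹
    letI C := c - b ⬝ᵥ (((τ / 2) • (1 : Matrix (Fin p) (Fin p) ℝ) + W)⁻¹ *ᵥ b)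
      + τ / 2 * Real.log (1 + (2 / τ) • W).det
    letI F (μ : Measure (Control p)) := ENNReal.ofReal τ * klDiv μ (stdGaussian (Control p))
        + ∫⁻ v, ENNReal.ofReal (quadForm W v + 2 * (b ⬝ᵥ v.ofLp) + c) ∂μ
    (∀ μ : Measure (Control p), IsProbabilityMeasure μ → F μ ≠ ∞ →
      F μ = ENNReal.ofReal τ * klDiv μ N + ENNReal.ofReal C) ∧
    F N = ENNReal.ofReal C := by
  have hW' : ((2 / τ) • W).PosSemidef := hW.smul (by positivity)
  obtain ⟨hint, hN, hlog⟩ := stdGaussian_tilted hW' ((2 / τ) • b)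
  have hD : ((τ / 2) • (1 : Matrix (Fin p) (Fin p) ℝ) + W)⁻¹ = (2 / τ) • (1 + (2 / τ) • W)⁻¹ := by
    have hu : IsUnit (1 + (2 / τ) • W).det :=
      (Matrix.PosSemidef.one_add_posDef hW').det_pos.ne'.isUnit
    refine Matrix.inv_eq_right_inv ?_
    have : (τ / 2) • (1 : Matrix (Fin p) (Fin p) ℝ) + W = (τ / 2) • (1 + (2 / τ) • W) := by
      rw [smul_add, smul_smul]
      have : τ / 2 * (2 / τ) = 1 := by field_simp
      rw [this, one_smul]
    rw [this, Matrix.smul_mul, Matrix.mul_smul, Matrix.mul_nonsing_inv _ hu, smul_smul]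
    have : τ / 2 * (2 / τ) = 1 := by field_simp
    rw [this, one_smul]
  set g := tiltExponent ((2 / τ) • W) ((2 / τ) • b) with hg
  have hgm : Measurable g := (continuous_tiltExponent _ _).measurable
  have hfg (v : Control p) : quadForm W v + 2 * (b ⬝ᵥ v.ofLp) + c = c - τ * g v := by
    simp only [hg, tiltExponent, quadForm_smul, smul_dotProduct, smul_eq_mul]
    field_simp
    ring
  have hmean : (WithLp.toLp 2 (-((1 + (2 / τ) • W)⁻¹ *ᵥ ((2 / τ) • b))) : Control p) =
      WithLp.toLp 2 (-(((τ / 2) • (1 : Matrix (Fin p) (Fin p) ℝ) + W)⁻¹ *ᵥ b)) := by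
    rw [hD, Matrix.mulVec_smul, Matrix.smul_mulVec]
  have hC : c - τ * Real.log (∫ v, Real.exp (g v) ∂(stdGaussian (Control p))) =
      c - b ⬝ᵥ (((τ / 2) • (1 : Matrix (Fin p) (Fin p) ℝ) + W)⁻¹ *ᵥ b)
      + τ / 2 * Real.log (1 + (2 / τ) • W).det := by
    rw [hlog, hD, Matrix.mulVec_smul, Matrix.smul_mulVec, smul_dotProduct, dotProduct_smul]
    simp only [smul_eq_mul]
    field_simp
    ring
  rw [hmean] at hN
  simp only [hfg] at hf ⊢
  rw [← hN, ← hC]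
  have hprob : IsProbabilityMeasure ((stdGaussian (Control p)).tilted g) :=
    isProbabilityMeasure_tilted hint
  have hgi : Integrable g ((stdGaussian (Control p)).tilted g) :=
    integrable_tiltExponent _ _ _ (hN ▸ IsGaussian.memLp_two_id)
  refine ⟨fun μ hμ hfin => gibbs_variational hτ hgm hint hf hfin, ?_⟩
  rw [gibbs_variational hτ hgm hint hf (free_energy_tilted_ne_top hint hf hgi), klDiv_self,
    mul_zero, zero_add]

/-! ### Expected quadratic forms -/

open scoped MatrixOrder Matrix.Norms.L2Operator in
/-- The symmetric square root of a positive semidefinite matrix. -/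
noncomputable def psdSqrt {n : ℕ} (P : Matrix (Fin n) (Fin n) ℝ) : Matrix (Fin n) (Fin n) ℝ :=
  CFC.sqrt P

open scoped MatrixOrder Matrix.Norms.L2Operator in
theorem psdSqrt_mul_self {n : ℕ} {P : Matrix (Fin n) (Fin n) ℝ} (hP : P.PosSemidef) :
    psdSqrt P * psdSqrt P = P :=
  CFC.sqrt_mul_sqrt_self _ hP.nonneg

open scoped MatrixOrder Matrix.Norms.L2Operator in
theorem psdSqrt_transpose {n : ℕ} (P : Matrix (Fin n) (Fin n) ℝ) : (psdSqrt P)ᵀ = psdSqrt P := by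
  have h : (psdSqrt P).IsHermitian := (CFC.sqrt_nonneg P).isSelfAdjoint
  exact (Matrix.conjTranspose_eq_transpose_of_trivial _).symm.trans h

theorem inner_toEuclideanLin {a b c : ℕ} (S : Matrix (Fin c) (Fin a) ℝ)
    (S' : Matrix (Fin c) (Fin b) ℝ)
    (x : EuclideanSpace ℝ (Fin a)) (y : EuclideanSpace ℝ (Fin b)) :
    inner ℝ (S.toEuclideanLin x) (S'.toEuclideanLin y) = x.ofLp ⬝ᵥ ((Sᵀ * S') *ᵥ y.ofLp) := by
  rw [EuclideanSpace.inner_eq_star_dotProduct, star_trivial, Matrix.ofLp_toLpLin,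
    Matrix.ofLp_toLpLin, Matrix.toLin'_apply, Matrix.toLin'_apply, dotProduct_comm,
    ← Matrix.vecMul_transpose, ← Matrix.dotProduct_mulVec, Matrix.mulVec_mulVec]

theorem quadForm_eq_norm_sq {n : ℕ} {P : Matrix (Fin n) (Fin n) ℝ} (hP : P.PosSemidef)
    (x : EuclideanSpace ℝ (Fin n)) : quadForm P x = ‖(psdSqrt P).toEuclideanLin x‖ ^ 2 := by
  rw [← real_inner_self_eq_norm_sq, inner_toEuclideanLin, psdSqrt_transpose, psdSqrt_mul_self hP,
    quadForm]

theorem quadForm_nonneg {n : ℕ} {P : Matrix (Fin n) (Fin n) ℝ} (hP : P.PosSemidef)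
    (x : EuclideanSpace ℝ (Fin n)) : 0 ≤ quadForm P x := by
  rw [quadForm_eq_norm_sq hP]; positivity

theorem continuous_toEuclideanLin {a b : ℕ} (S : Matrix (Fin a) (Fin b) ℝ) :
    Continuous fun x : EuclideanSpace ℝ (Fin b) => S.toEuclideanLin x :=
  LinearMap.continuous_of_finiteDimensional _

section NormSq

variable {Ω E : Type*} [MeasurableSpace Ω] {μ : Measure Ω} [IsProbabilityMeasure μ]
  [NormedAddCommGroup E] [InnerProductSpace ℝ E] [FiniteDimensional ℝ E] {Y : Ω → E}

theorem memLp_two_of_lintegral_norm_sq_ne_top [MeasurableSpace E] [BorelSpace E]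
    (hY : Measurable Y) (a : E) {q : ℝ} (hq : 0 ≤ q)
    (h : ∫⁻ z, ENNReal.ofReal (‖a + Y z‖ ^ 2 + q) ∂μ ≠ ∞) : MemLp Y 2 μ := by
  have h1 : MemLp (fun z => a + Y z) 2 μ := by
    rw [memLp_two_iff_integrable_sq_norm (hY.const_add a).aestronglyMeasurable]
    refine ⟨by fun_prop, ?_⟩
    rw [hasFiniteIntegral_iff_ofReal (ae_of_all _ fun z => by positivity)]
    refine lt_of_le_of_lt (lintegral_mono fun z => ENNReal.ofReal_le_ofReal ?_) h.lt_top
    simpa using hq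
  refine ((memLp_const (-a)).add h1).ae_eq (ae_of_all _ fun z => ?_)
  simp

theorem lintegral_norm_sq_add (hY : MemLp Y 2 μ) (a : E) {q : ℝ} (hq : 0 ≤ q) :
    ∫⁻ z, ENNReal.ofReal (‖a + Y z‖ ^ 2 + q) ∂μ =
      ENNReal.ofReal (‖a‖ ^ 2 + 2 * inner ℝ a (∫ z, Y z ∂μ) + (∫ z, ‖Y z‖ ^ 2 ∂μ) + q) := by
  have hi : Integrable Y μ := hY.integrable (by norm_num)
  have hsq : Integrable (fun z => ‖Y z‖ ^ 2) μ :=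
    (memLp_two_iff_integrable_sq_norm hY.1).1 hY
  have hin : Integrable (fun z => (inner ℝ a (Y z) : ℝ)) μ := hi.const_inner a
  have heq (z : Ω) : ‖a + Y z‖ ^ 2 + q = ‖a‖ ^ 2 + 2 * inner ℝ a (Y z) + ‖Y z‖ ^ 2 + q := by
    rw [norm_add_sq_real]
  have hint : Integrable (fun z => ‖a‖ ^ 2 + 2 * inner ℝ a (Y z) + ‖Y z‖ ^ 2 + q) μ :=
    (((integrable_const _).add (hin.const_mul 2)).add hsq).add (integrable_const _)
  simp_rw [heq]
  rw [← ofReal_integral_eq_lintegral_ofReal hint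
    (ae_of_all _ fun z => by simp only [Pi.zero_apply]; rw [← heq]; positivity)]
  congr 1
  have h1 : Integrable (fun z => ‖a‖ ^ 2 + 2 * inner ℝ a (Y z)) μ :=
    (integrable_const _).add (hin.const_mul 2)
  have h2 : Integrable (fun z => ‖a‖ ^ 2 + 2 * inner ℝ a (Y z) + ‖Y z‖ ^ 2) μ := h1.add hsq
  rw [integral_add h2 (integrable_const _), integral_add h1 hsq,
    integral_add (integrable_const _) (hin.const_mul 2), integral_const_mul, integral_inner hi a]
  simp

end NormSq

/-! ### One stage of the game -/

namespace LQGame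

variable {N m p : ℕ} (G : LQGame N m p)

/-- The joint law of the actions and of the noise, when the actions are independent with laws
`ν j`. -/
noncomputable def actionNoise (ν : Fin N → Measure (Control p)) :
    Measure ((Fin N → Control p) × State m) :=
  (Measure.pi ν).prod (multivariateGaussian 0 G.noiseCov)

instance (ν : Fin N → Measure (Control p)) [∀ j, IsProbabilityMeasure (ν j)] :
    IsProbabilityMeasure (G.actionNoise ν) := by
  unfold actionNoise; infer_instance

/-- The part of the next state that does not depend on the action of agent `i`. -/
noncomputable def rest (i : Fin N) (t : ℕ) (x : State m) (z : (Fin N → Control p) × State m) :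
    State m :=
  (G.A t).toEuclideanLin x + ∑ j ∈ Finset.univ.erase i, (G.B j t).toEuclideanLin (z.1 j) + z.2

/-- The law of the next state, when the actions are independent with laws `ν j`. -/
noncomputable def next (t : ℕ) (x : State m) (ν : Fin N → Measure (Control p)) :
    Measure (State m) :=
  (G.actionNoise ν).map fun z => G.drift t x z.1 + z.2

theorem measurable_rest_uncurry {α : Type*} [MeasurableSpace α] (i : Fin N) (t : ℕ)
    {c : α → State m} (hc : Measurable c) :
    Measurable fun y : α × ((Fin N → Control p) × State m) => G.rest i t (c y.1) y.2 := by
  have h1 := (continuous_toEuclideanLin (G.A t)).measurable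
  have h2 := fun j => (continuous_toEuclideanLin (G.B j t)).measurable
  have hu : Measurable fun y : α × ((Fin N → Control p) × State m) => y.2.1 :=
    measurable_fst.comp measurable_snd
  refine Measurable.add (Measurable.add (h1.comp (hc.comp measurable_fst)) ?_)
    (measurable_snd.comp measurable_snd)
  exact Finset.measurable_sum _ fun j _ => (h2 j).comp ((measurable_pi_apply j).comp hu)

theorem measurable_rest (i : Fin N) (t : ℕ) (x : State m) : Measurable (G.rest i t x) := by
  have h2 := fun j => (continuous_toEuclideanLin (G.B j t)).measurable
  refine Measurable.add (Measurable.add measurable_const ?_) measurable_snd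
  exact Finset.measurable_sum _ fun j _ =>
    (h2 j).comp ((measurable_pi_apply j).comp measurable_fst)

theorem measurable_drift_add_uncurry {α : Type*} [MeasurableSpace α] (t : ℕ)
    {c : α → State m} (hc : Measurable c) :
    Measurable fun y : α × ((Fin N → Control p) × State m) => G.drift t (c y.1) y.2.1 + y.2.2 := by
  have h1 := (continuous_toEuclideanLin (G.A t)).measurable
  have h2 := fun j => (continuous_toEuclideanLin (G.B j t)).measurable
  have hu : Measurable fun y : α × ((Fin N → Control p) × State m) => y.2.1 :=
    measurable_fst.comp measurable_snd
  refine Measurable.add (Measurable.add (h1.comp (hc.comp measurable_fst)) ?_)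
    (measurable_snd.comp measurable_snd)
  exact Finset.measurable_sum _ fun j _ => (h2 j).comp ((measurable_pi_apply j).comp hu)

theorem measurable_drift_add (t : ℕ) (x : State m) :
    Measurable fun z : (Fin N → Control p) × State m => G.drift t x z.1 + z.2 := by
  have h2 := fun j => (continuous_toEuclideanLin (G.B j t)).measurable
  refine Measurable.add (Measurable.add measurable_const ?_) measurable_snd
  exact Finset.measurable_sum _ fun j _ =>
    (h2 j).comp ((measurable_pi_apply j).comp measurable_fst)

instance (t : ℕ) (x : State m) (ν : Fin N → Measure (Control p))
    [∀ j, IsProbabilityMeasure (ν j)] : IsProbabilityMeasure (G.next t x ν) :=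
  Measure.isProbabilityMeasure_map (G.measurable_drift_add t x).aemeasurable

/-- The next state, split into the contribution of the action of agent `i` and the rest. -/
theorem drift_update_add (i : Fin N) (t : ℕ) (x : State m) (v : Control p)
    (z : (Fin N → Control p) × State m) :
    G.drift t x (Function.update z.1 i v) + z.2 = (G.B i t).toEuclideanLin v + G.rest i t x z := by
  rw [drift, rest, ← Finset.add_sum_erase _ _ (Finset.mem_univ i), Function.update_self]
  have : ∑ j ∈ Finset.univ.erase i, (G.B j t).toEuclideanLin (Function.update z.1 i v j) =
      ∑ j ∈ Finset.univ.erase i, (G.B j t).toEuclideanLin (z.1 j) :=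
    Finset.sum_congr rfl fun j hj => by rw [Function.update_of_ne (Finset.ne_of_mem_erase hj)]
  rw [this]
  abel

end LQGame

theorem isProbabilityMeasure_update {N : ℕ} {U : Type*} [MeasurableSpace U]
    (ν : Fin N → Measure U) [∀ j, IsProbabilityMeasure (ν j)] (i : Fin N) (μ : Measure U)
    [IsProbabilityMeasure μ] (j : Fin N) : IsProbabilityMeasure (Function.update ν i μ j) := by
  by_cases h : j = i
  · subst h; simpa
  · rw [Function.update_of_ne h]; infer_instance

theorem measurable_update_fst {N : ℕ} {U : Type*} [MeasurableSpace U] (i : Fin N) :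
    Measurable fun z : U × (Fin N → U) => Function.update z.2 i z.1 := by
  refine measurable_pi_lambda _ fun j => ?_
  by_cases h : j = i
  · subst h; simpa using measurable_fst
  · simp only [Function.update_of_ne h]
    exact (measurable_pi_apply j).comp measurable_snd

/-- Resampling one coordinate of a product measure. -/
theorem pi_update_eq_map {N : ℕ} {U : Type*} [MeasurableSpace U]
    (ν : Fin N → Measure U) [∀ j, IsProbabilityMeasure (ν j)] (i : Fin N) (μ : Measure U)
    [IsProbabilityMeasure μ] :
    Measure.pi (Function.update ν i μ) =
      (μ.prod (Measure.pi ν)).map fun z => Function.update z.2 i z.1 := by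
  have := isProbabilityMeasure_update ν i μ
  refine Measure.pi_eq fun s hs => ?_
  have hm : Measurable fun z : U × (Fin N → U) => Function.update z.2 i z.1 :=
    measurable_update_fst i
  rw [Measure.map_apply hm (MeasurableSet.univ_pi hs)]
  have hpre : (fun z : U × (Fin N → U) => Function.update z.2 i z.1) ⁻¹' Set.univ.pi s =
      s i ×ˢ Set.univ.pi (Function.update s i Set.univ) := by
    ext z
    simp only [Set.mem_preimage, Set.mem_pi, Set.mem_univ, true_imp_iff, Set.mem_prod]
    constructor
    · intro h
      refine ⟨by simpa using h i, fun j => ?_⟩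
      by_cases hj : j = i
      · subst hj; simp
      · simpa [Function.update_of_ne hj] using h j
    · rintro ⟨h1, h2⟩ j
      by_cases hj : j = i
      · subst hj; simpa
      · simpa [Function.update_of_ne hj] using h2 j
  rw [hpre, Measure.prod_prod, Measure.pi_pi, ← Finset.mul_prod_erase _ _ (Finset.mem_univ i),
    ← Finset.mul_prod_erase (Finset.univ : Finset (Fin N)) (fun j => Function.update ν i μ j (s j))
      (Finset.mem_univ i)]
  simp only [Function.update_self, measure_univ, one_mul]
  congr 1
  exact Finset.prod_congr rfl fun j hj => by
    simp [Function.update_of_ne (Finset.ne_of_mem_erase hj)]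

/-- Absolute continuity is preserved by resampling one coordinate. -/
theorem pi_update_absolutelyContinuous {N : ℕ} {U : Type*} [MeasurableSpace U]
    (ν : Fin N → Measure U) [∀ j, IsProbabilityMeasure (ν j)] (i : Fin N) (μ : Measure U)
    [IsProbabilityMeasure μ] (h : μ ≪ ν i) :
    Measure.pi (Function.update ν i μ) ≪ Measure.pi ν := by
  have h2 : Measure.pi ν = Measure.pi (Function.update ν i (ν i)) := by
    rw [Function.update_eq_self]
  rw [h2, pi_update_eq_map, pi_update_eq_map]
  refine Measure.AbsolutelyContinuous.map (h.prod Measure.AbsolutelyContinuous.rfl)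
    (measurable_update_fst i)

namespace LQGame

variable {N m p : ℕ} (G : LQGame N m p)

theorem next_update_absolutelyContinuous (t : ℕ) (x : State m) (ν : Fin N → Measure (Control p))
    [∀ j, IsProbabilityMeasure (ν j)] (i : Fin N) (μ : Measure (Control p))
    [IsProbabilityMeasure μ] (h : μ ≪ ν i) :
    G.next t x (Function.update ν i μ) ≪ G.next t x ν :=
  Measure.AbsolutelyContinuous.map
    ((pi_update_absolutelyContinuous ν i μ h).prod Measure.AbsolutelyContinuous.rfl)
    (G.measurable_drift_add t x)

/-- The action of agent `i` is independent of the rest of the next state. -/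
theorem lintegral_next_update (t : ℕ) (x : State m) (ν : Fin N → Measure (Control p))
    [∀ j, IsProbabilityMeasure (ν j)] (i : Fin N) (μ : Measure (Control p))
    [IsProbabilityMeasure μ] {V : State m → ℝ≥0∞} (hV : Measurable V) :
    ∫⁻ y, V y ∂(G.next t x (Function.update ν i μ)) =
      ∫⁻ v, ∫⁻ z, V ((G.B i t).toEuclideanLin v + G.rest i t x z) ∂(G.actionNoise ν) ∂μ := by
  have := isProbabilityMeasure_update ν i μ
  have hm : Measurable fun z : Control p × (Fin N → Control p) => Function.update z.2 i z.1 :=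
    measurable_update_fst i
  have hB := (continuous_toEuclideanLin (G.B i t)).measurable
  have hd := G.measurable_drift_add t x
  have hr := G.measurable_rest i t x
  have hF : Measurable fun z : (Fin N → Control p) × State m => V (G.drift t x z.1 + z.2) :=
    hV.comp hd
  rw [next, lintegral_map hV hd, actionNoise, lintegral_prod _ hF.aemeasurable,
    pi_update_eq_map, lintegral_map hF.lintegral_prod_right' hm, lintegral_prod]
  · refine lintegral_congr fun v => ?_
    have hG : Measurable fun z : (Fin N → Control p) × State m =>
        V ((G.B i t).toEuclideanLin v + G.rest i t x z) := hV.comp (hr.const_add _)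
    rw [actionNoise, lintegral_prod _ hG.aemeasurable]
    refine lintegral_congr fun u => lintegral_congr fun w => ?_
    rw [← G.drift_update_add i t x v (u, w)]
  · exact (hF.lintegral_prod_right'.comp hm).aemeasurable

end LQGame

/-! ### Best responses -/

namespace LQGame

variable {N m p : ℕ} (G : LQGame N m p)

/-- The expected stage cost of agent `i` at time `t` in the state `x`, when it draws its action
from `μ`. -/
noncomputable def stage (i : Fin N) (t : ℕ) (x : State m) (μ : Measure (Control p)) : ℝ≥0∞ :=
  ENNReal.ofReal (quadForm (G.Q i t) x) + ∫⁻ u, ENNReal.ofReal (quadForm (G.R i t) u) ∂μ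
    + ENNReal.ofReal G.τ * InformationTheory.klDiv μ (G.prior i t x)

/-- The candidate value function `xᵀ P^i_t x + q^i_t`. -/
noncomputable def quadValue (P : Fin N → ℕ → Matrix (Fin m) (Fin m) ℝ) (q : Fin N → ℕ → ℝ)
    (i : Fin N) (t : ℕ) (x : State m) : ℝ≥0∞ :=
  ENNReal.ofReal (quadForm (P i t) x + q i t)

theorem measurable_quadValue (P : Fin N → ℕ → Matrix (Fin m) (Fin m) ℝ) (q : Fin N → ℕ → ℝ)
    (i : Fin N) (t : ℕ) : Measurable (quadValue P q i t) :=
  ((continuous_quadForm (P i t)).measurable.add_const _).ennreal_ofReal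

/-- The linear coefficient, in agent `i`'s action, of its expected cost-to-go. It is written with
the square root of `P^i_{t+1}`, since `(P^i_{t+1})^{1/2}` applied to the other agents' contribution
to the next state may be integrable when this contribution is not. -/
noncomputable def linCoeff (P : Fin N → ℕ → Matrix (Fin m) (Fin m) ℝ) (i : Fin N) (t : ℕ)
    (x : State m) (ν : Fin N → Measure (Control p)) : Fin p → ℝ :=
  (G.B i t)ᵀ *ᵥ (psdSqrt (P i (t + 1)) *ᵥ
    (∫ z, (psdSqrt (P i (t + 1))).toEuclideanLin (G.rest i t x z) ∂(G.actionNoise ν)).ofLp)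

/-- The mean of agent `i`'s best response to the action laws `ν j` of the others. -/
noncomputable def bestMean (P : Fin N → ℕ → Matrix (Fin m) (Fin m) ℝ) (i : Fin N) (t : ℕ)
    (x : State m) (ν : Fin N → Measure (Control p)) : Control p :=
  WithLp.toLp 2 (-((G.regWeight P i t)⁻¹ *ᵥ G.linCoeff P i t x ν))

/-- Agent `i`'s best response to the action laws `ν j` of the others. -/
noncomputable def bestResponse (P : Fin N → ℕ → Matrix (Fin m) (Fin m) ℝ) (i : Fin N) (t : ℕ)
    (x : State m) (ν : Fin N → Measure (Control p)) : Measure (Control p) :=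
  multivariateGaussian (G.bestMean P i t x ν) (G.nashCov P i t)

instance (P : Fin N → ℕ → Matrix (Fin m) (Fin m) ℝ) (i : Fin N) (t : ℕ)
    (x : State m) (ν : Fin N → Measure (Control p)) :
    IsProbabilityMeasure (G.bestResponse P i t x ν) := by
  unfold bestResponse; infer_instance

/-- The cost of agent `i`'s best response. -/
noncomputable def minCost (P : Fin N → ℕ → Matrix (Fin m) (Fin m) ℝ) (q : Fin N → ℕ → ℝ)
    (i : Fin N) (t : ℕ) (x : State m) (ν : Fin N → Measure (Control p)) : ℝ :=
  quadForm (G.Q i t) x +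
    ((∫ z, ‖(psdSqrt (P i (t + 1))).toEuclideanLin (G.rest i t x z)‖ ^ 2 ∂(G.actionNoise ν))
      + q i (t + 1))
    - G.linCoeff P i t x ν ⬝ᵥ ((G.regWeight P i t)⁻¹ *ᵥ G.linCoeff P i t x ν)
    + G.τ / 2 * Real.log (1 + (2 / G.τ) • G.weight P i t).det

variable {G} {P : Fin N → ℕ → Matrix (Fin m) (Fin m) ℝ} {q : Fin N → ℕ → ℝ} {i : Fin N} {t : ℕ}

theorem weight_posSemidef (ht : t < G.T) (hP : (P i (t + 1)).PosSemidef) :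
    (G.weight P i t).PosSemidef := by
  have := hP.conjTranspose_mul_mul_same (G.B i t)
  rw [Matrix.conjTranspose_eq_transpose_of_trivial] at this
  exact (G.R_posDef i t ht).posSemidef.add this

theorem regWeight_posDef (ht : t < G.T) (hP : (P i (t + 1)).PosSemidef) :
    (G.regWeight P i t).PosDef :=
  (Matrix.PosDef.one.smul (half_pos G.τ_pos)).add_posSemidef (weight_posSemidef ht hP)

theorem nashCov_posSemidef (ht : t < G.T) (hP : (P i (t + 1)).PosSemidef) :
    (G.nashCov P i t).PosSemidef :=
  (Matrix.PosSemidef.one_add_posDef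
    ((weight_posSemidef ht hP).smul (by have := G.τ_pos; positivity))).inv.posSemidef

theorem quadValue_eq_norm_sq (hP : (P i t).PosSemidef) (y : State m) :
    quadValue P q i t y =
      ENNReal.ofReal (‖(psdSqrt (P i t)).toEuclideanLin y‖ ^ 2 + q i t) := by
  rw [quadValue, quadForm_eq_norm_sq hP]

variable {x : State m} {ν : Fin N → Measure (Control p)} [∀ j, IsProbabilityMeasure (ν j)]

theorem measurable_psdSqrt_rest :
    Measurable fun z => (psdSqrt (P i (t + 1))).toEuclideanLin (G.rest i t x z) :=
  (continuous_toEuclideanLin _).measurable.comp (G.measurable_rest i t x)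

/-- If some action law of agent `i` has a finite cost, then the other agents' contribution to the
next state is square integrable in the directions seen by `P^i_{t+1}`. -/
theorem memLp_rest_of_ne_top (hP : (P i (t + 1)).PosSemidef) (hq : 0 ≤ q i (t + 1))
    {μ : Measure (Control p)} [IsProbabilityMeasure μ]
    (h : ∫⁻ y, quadValue P q i (t + 1) y ∂(G.next t x (Function.update ν i μ)) ≠ ∞) :
    MemLp (fun z => (psdSqrt (P i (t + 1))).toEuclideanLin (G.rest i t x z)) 2
      (G.actionNoise ν) := by
  rw [G.lintegral_next_update t x ν i μ (measurable_quadValue _ _ _ _)] at h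
  have hm : Measurable fun v => ∫⁻ z, quadValue P q i (t + 1)
      ((G.B i t).toEuclideanLin v + G.rest i t x z) ∂(G.actionNoise ν) := by
    have h1 : Measurable fun w : Control p × ((Fin N → Control p) × State m) =>
        quadValue P q i (t + 1) ((G.B i t).toEuclideanLin w.1 + G.rest i t x w.2) :=
      (measurable_quadValue _ _ _ _).comp
        (((continuous_toEuclideanLin _).measurable.comp measurable_fst).add
          ((G.measurable_rest i t x).comp measurable_snd))
    exact h1.lintegral_prod_right'
  obtain ⟨v, hv⟩ := (ae_lt_top hm h).exists
  simp only [quadValue_eq_norm_sq hP, map_add] at hv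
  exact memLp_two_of_lintegral_norm_sq_ne_top measurable_psdSqrt_rest _ hq hv.ne

/-- The cost of an action law of agent `i` as a free energy with a quadratic potential. -/
theorem stage_add_next_eq (ht : t < G.T) (hprior : G.prior i t x = stdGaussian (Control p))
    (hP : (P i (t + 1)).PosSemidef) (hq : 0 ≤ q i (t + 1))
    (hL : MemLp (fun z => (psdSqrt (P i (t + 1))).toEuclideanLin (G.rest i t x z)) 2
      (G.actionNoise ν)) :
    letI c := quadForm (G.Q i t) x +
      ((∫ z, ‖(psdSqrt (P i (t + 1))).toEuclideanLin (G.rest i t x z)‖ ^ 2 ∂(G.actionNoise ν))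
      + q i (t + 1))
    letI f (v : Control p) := quadForm (G.weight P i t) v + 2 * (G.linCoeff P i t x ν ⬝ᵥ v.ofLp) + c
    (∀ v, 0 ≤ f v) ∧ ∀ μ : Measure (Control p), IsProbabilityMeasure μ →
      G.stage i t x μ + ∫⁻ y, quadValue P q i (t + 1) y ∂(G.next t x (Function.update ν i μ)) =
        ENNReal.ofReal G.τ * InformationTheory.klDiv μ (stdGaussian (Control p))
          + ∫⁻ v, ENNReal.ofReal (f v) ∂μ := by
  set S := psdSqrt (P i (t + 1)) with hS
  have hST : Sᵀ = S := psdSqrt_transpose _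
  set Y := fun z => S.toEuclideanLin (G.rest i t x z) with hY
  have hQ : 0 ≤ quadForm (G.Q i t) x := quadForm_nonneg (G.Q_posSemidef i t ht.le) x
  have hR (v : Control p) : 0 ≤ quadForm (G.R i t) v :=
    quadForm_nonneg (G.R_posDef i t ht).posSemidef v
  set g := fun v : Control p => ‖S.toEuclideanLin ((G.B i t).toEuclideanLin v)‖ ^ 2
    + 2 * inner ℝ (S.toEuclideanLin ((G.B i t).toEuclideanLin v)) (∫ z, Y z ∂(G.actionNoise ν))
    + (∫ z, ‖Y z‖ ^ 2 ∂(G.actionNoise ν)) + q i (t + 1) with hg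
  have hint (v : Control p) : ∫⁻ z, quadValue P q i (t + 1)
      ((G.B i t).toEuclideanLin v + G.rest i t x z) ∂(G.actionNoise ν) = ENNReal.ofReal (g v) := by
    simp only [quadValue_eq_norm_sq hP, map_add]
    exact lintegral_norm_sq_add hL _ hq
  -- `g` is a second moment plus `q`, nonnegative because `‖E Y‖² ≤ E ‖Y‖²`
  have hg0 (v : Control p) : 0 ≤ g v := by
    have h1 := norm_add_sq_real (S.toEuclideanLin ((G.B i t).toEuclideanLin v))
      (∫ z, Y z ∂(G.actionNoise ν))
    have h2 : ‖∫ z, Y z ∂(G.actionNoise ν)‖ ^ 2 ≤ ∫ z, ‖Y z‖ ^ 2 ∂(G.actionNoise ν) := by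
      refine le_trans (pow_le_pow_left₀ (norm_nonneg _) (norm_integral_le_integral_norm _) 2) ?_
      have hv := variance_eq_sub hL.norm
      have := variance_nonneg (fun z => ‖Y z‖) (G.actionNoise ν)
      rw [hv] at this
      simpa using this
    have h3 := sq_nonneg ‖S.toEuclideanLin ((G.B i t).toEuclideanLin v)
      + ∫ z, Y z ∂(G.actionNoise ν)‖
    simp only [hg]
    linarith
  have hfg (v : Control p) : quadForm (G.weight P i t) v
      + 2 * (G.linCoeff P i t x ν ⬝ᵥ v.ofLp) + (quadForm (G.Q i t) x +
      ((∫ z, ‖Y z‖ ^ 2 ∂(G.actionNoise ν)) + q i (t + 1))) =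
      quadForm (G.Q i t) x + quadForm (G.R i t) v + g v := by
    have e1 : ‖S.toEuclideanLin ((G.B i t).toEuclideanLin v)‖ ^ 2 =
        v.ofLp ⬝ᵥ (((G.B i t)ᵀ * P i (t + 1) * G.B i t) *ᵥ v.ofLp) := by
      rw [hS, ← quadForm_eq_norm_sq hP, quadForm, Matrix.ofLp_toLpLin, Matrix.toLin'_apply,
        Matrix.mulVec_mulVec, ← Matrix.vecMul_transpose, ← Matrix.dotProduct_mulVec,
        Matrix.mulVec_mulVec, Matrix.mul_assoc]
    have e2 : inner ℝ (S.toEuclideanLin ((G.B i t).toEuclideanLin v))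
        (∫ z, Y z ∂(G.actionNoise ν)) = G.linCoeff P i t x ν ⬝ᵥ v.ofLp := by
      rw [EuclideanSpace.inner_eq_star_dotProduct, star_trivial, Matrix.ofLp_toLpLin,
        Matrix.ofLp_toLpLin, Matrix.toLin'_apply, Matrix.toLin'_apply, linCoeff,
        Matrix.dotProduct_mulVec, Matrix.dotProduct_mulVec, Matrix.mulVec_transpose, ← hS,
        ← Matrix.vecMul_transpose S, hST]
    have e3 : quadForm (G.weight P i t) v = quadForm (G.R i t) v
        + v.ofLp ⬝ᵥ (((G.B i t)ᵀ * P i (t + 1) * G.B i t) *ᵥ v.ofLp) := by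
      rw [quadForm, weight, Matrix.add_mulVec, dotProduct_add, quadForm]
    simp only [hg]
    rw [e1, e2, e3]
    ring
  refine ⟨fun v => ?_, fun μ hμ => ?_⟩
  · exact le_of_le_of_eq (add_nonneg (add_nonneg hQ (hR v)) (hg0 v)) (hfg v).symm
  · rw [G.lintegral_next_update t x ν i μ (measurable_quadValue _ _ _ _), lintegral_congr hint]
    rw [lintegral_congr fun v => congrArg ENNReal.ofReal (hfg v)]
    have hRm : Measurable fun v : Control p => ENNReal.ofReal (quadForm (G.R i t) v) :=
      (continuous_quadForm _).measurable.ennreal_ofReal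
    have hsplit (v : Control p) : ENNReal.ofReal (quadForm (G.Q i t) x + quadForm (G.R i t) v + g v)
        = ENNReal.ofReal (quadForm (G.Q i t) x) + (ENNReal.ofReal (quadForm (G.R i t) v)
          + ENNReal.ofReal (g v)) := by
      rw [ENNReal.ofReal_add (add_nonneg hQ (hR v)) (hg0 v), ENNReal.ofReal_add hQ (hR v),
        add_assoc]
    simp_rw [hsplit]
    rw [lintegral_add_left measurable_const, lintegral_add_left hRm, lintegral_const, measure_univ,
      mul_one, stage, hprior]
    ring

/-- The cost of an action law of agent `i` exceeds the cost of the best response by `τ` times the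
divergence from the best response. The best response itself has a finite cost, so it is the
unique minimizer. -/
theorem stage_add_next_eq_klDiv (ht : t < G.T) (hprior : G.prior i t x = stdGaussian (Control p))
    (hP : (P i (t + 1)).PosSemidef) (hq : 0 ≤ q i (t + 1))
    (hL : MemLp (fun z => (psdSqrt (P i (t + 1))).toEuclideanLin (G.rest i t x z)) 2
      (G.actionNoise ν)) :
    (∀ μ : Measure (Control p), IsProbabilityMeasure μ →
      G.stage i t x μ + ∫⁻ y, quadValue P q i (t + 1) y ∂(G.next t x (Function.update ν i μ)) ≠ ∞ →
      G.stage i t x μ + ∫⁻ y, quadValue P q i (t + 1) y ∂(G.next t x (Function.update ν i μ)) =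
        ENNReal.ofReal G.τ * InformationTheory.klDiv μ (G.bestResponse P i t x ν)
          + ENNReal.ofReal (G.minCost P q i t x ν)) ∧
    G.stage i t x (G.bestResponse P i t x ν)
      + ∫⁻ y, quadValue P q i (t + 1) y
          ∂(G.next t x (Function.update ν i (G.bestResponse P i t x ν))) =
        ENNReal.ofReal (G.minCost P q i t x ν) := by
  obtain ⟨hf, heq⟩ := stage_add_next_eq (ν := ν) ht hprior hP hq hL
  obtain ⟨h1, h2⟩ := quadratic_gibbs G.τ_pos (weight_posSemidef ht hP) _ hf
  refine ⟨fun μ hμ hfin => ?_, ?_⟩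
  · rw [heq μ hμ] at hfin ⊢
    exact h1 μ hμ hfin
  · rw [heq _ inferInstance]
    exact h2

end LQGame

/-! ### Gaussian action profiles -/

theorem inner_toLp_eq {n : ℕ} (c : Fin n → ℝ) (u : EuclideanSpace ℝ (Fin n)) :
    inner ℝ (WithLp.toLp 2 c : EuclideanSpace ℝ (Fin n)) u = c ⬝ᵥ u.ofLp := by
  rw [EuclideanSpace.inner_eq_star_dotProduct, star_trivial, dotProduct_comm]

section LinearFunctional

variable {n : ℕ} (c : Fin n → ℝ) (h : EuclideanSpace ℝ (Fin n)) {S : Matrix (Fin n) (Fin n) ℝ}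

theorem memLp_dotProduct_multivariateGaussian :
    MemLp (fun u : EuclideanSpace ℝ (Fin n) => c ⬝ᵥ u.ofLp) 2 (multivariateGaussian h S) := by
  simp_rw [← inner_toLp_eq]
  exact (IsGaussian.memLp_two_id (μ := multivariateGaussian h S)).const_inner
    (WithLp.toLp 2 c : EuclideanSpace ℝ (Fin n))

theorem integral_dotProduct_multivariateGaussian :
    ∫ u : EuclideanSpace ℝ (Fin n), c ⬝ᵥ u.ofLp ∂(multivariateGaussian h S) = c ⬝ᵥ h.ofLp := by
  simp_rw [← inner_toLp_eq]
  rw [integral_inner IsGaussian.integrable_fun_id, integral_id_multivariateGaussian]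

theorem variance_dotProduct_multivariateGaussian (hS : S.PosSemidef) :
    Var[fun u : EuclideanSpace ℝ (Fin n) => c ⬝ᵥ u.ofLp; multivariateGaussian h S] =
      c ⬝ᵥ (S *ᵥ c) := by
  simp_rw [← inner_toLp_eq]
  rw [← covarianceBilin_self IsGaussian.memLp_two_id, covarianceBilin_multivariateGaussian hS]

end LinearFunctional

namespace LQGame

variable {N m p : ℕ} {G : LQGame N m p} {i : Fin N} {t : ℕ} {x : State m}

theorem dotProduct_rest (a : Fin m → ℝ) (z : (Fin N → Control p) × State m) :
    a ⬝ᵥ (G.rest i t x z).ofLp = (a ⬝ᵥ (G.A t *ᵥ x.ofLp)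
      + ∑ j, (if j = i then 0 else (a ᵥ* G.B j t)) ⬝ᵥ (z.1 j).ofLp) + a ⬝ᵥ z.2.ofLp := by
  have h1 : ∑ j, (if j = i then 0 else (a ᵥ* G.B j t)) ⬝ᵥ (z.1 j).ofLp =
      ∑ j ∈ Finset.univ.erase i, (a ᵥ* G.B j t) ⬝ᵥ (z.1 j).ofLp := by
    rw [← Finset.add_sum_erase _ _ (Finset.mem_univ i)]
    simp only [if_true, zero_dotProduct, zero_add]
    exact Finset.sum_congr rfl fun j hj => by rw [if_neg (Finset.ne_of_mem_erase hj)]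
  rw [h1, rest]
  simp only [WithLp.ofLp_add, WithLp.ofLp_sum, dotProduct_add, dotProduct_sum,
    Matrix.ofLp_toLpLin, Matrix.toLin'_apply, Matrix.dotProduct_mulVec]

variable (h : Fin N → Control p) {S : Fin N → Matrix (Fin p) (Fin p) ℝ}

theorem memLp_dotProduct_action (j : Fin N) (c : Fin p → ℝ) :
    MemLp (fun z : (Fin N → Control p) × State m => c ⬝ᵥ (z.1 j).ofLp) 2
      (G.actionNoise fun j => multivariateGaussian (h j) (S j)) :=
  (memLp_dotProduct_multivariateGaussian c (h j)).comp_measurePreserving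
    ((measurePreserving_eval _ j).comp measurePreserving_fst)

theorem memLp_dotProduct_noise (a : Fin m → ℝ) :
    MemLp (fun z : (Fin N → Control p) × State m => a ⬝ᵥ z.2.ofLp) 2
      (G.actionNoise fun j => multivariateGaussian (h j) (S j)) :=
  (memLp_dotProduct_multivariateGaussian a 0).comp_measurePreserving measurePreserving_snd

theorem memLp_dotProduct_rest (a : Fin m → ℝ) :
    MemLp (fun z => a ⬝ᵥ (G.rest i t x z).ofLp) 2
      (G.actionNoise fun j => multivariateGaussian (h j) (S j)) := by
  have hs : MemLp (fun z : (Fin N → Control p) × State m =>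
      ∑ j, (if j = i then 0 else (a ᵥ* G.B j t)) ⬝ᵥ (z.1 j).ofLp) 2
      (G.actionNoise fun j => multivariateGaussian (h j) (S j)) :=
    memLp_finsetSum _ fun j _ => memLp_dotProduct_action h j _
  have hc : MemLp (fun _ : (Fin N → Control p) × State m => a ⬝ᵥ (G.A t *ᵥ x.ofLp)) 2
      (G.actionNoise fun j => multivariateGaussian (h j) (S j)) := memLp_const _
  have hn := (hc.add hs).add (memLp_dotProduct_noise h a)
  have he : (fun z => a ⬝ᵥ (G.rest i t x z).ofLp) = _ := funext (dotProduct_rest a)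
  rw [he]
  exact hn

theorem integral_dotProduct_rest (a : Fin m → ℝ) :
    ∫ z, a ⬝ᵥ (G.rest i t x z).ofLp ∂(G.actionNoise fun j => multivariateGaussian (h j) (S j)) =
      a ⬝ᵥ (G.rest i t x (h, 0)).ofLp := by
  simp_rw [dotProduct_rest]
  have hj (j : Fin N) : Integrable (fun z : (Fin N → Control p) × State m =>
      (if j = i then 0 else (a ᵥ* G.B j t)) ⬝ᵥ (z.1 j).ofLp)
      (G.actionNoise fun j => multivariateGaussian (h j) (S j)) :=
    (memLp_dotProduct_action h j _).integrable (by norm_num)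
  have hn : Integrable (fun z : (Fin N → Control p) × State m => a ⬝ᵥ z.2.ofLp)
      (G.actionNoise fun j => multivariateGaussian (h j) (S j)) :=
    (memLp_dotProduct_noise h a).integrable (by norm_num)
  have hs := integrable_finsetSum Finset.univ fun j _ => hj j
  have hc : Integrable (fun z : (Fin N → Control p) × State m => a ⬝ᵥ (G.A t *ᵥ x.ofLp)
      + ∑ j, (if j = i then 0 else (a ᵥ* G.B j t)) ⬝ᵥ (z.1 j).ofLp)
      (G.actionNoise fun j => multivariateGaussian (h j) (S j)) := (integrable_const _).add hs
  rw [integral_add hc hn, integral_add (integrable_const _) hs,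
    integral_finsetSum _ fun j _ => hj j]
  have e1 : ∫ z : (Fin N → Control p) × State m, a ⬝ᵥ z.2.ofLp
      ∂(G.actionNoise fun j => multivariateGaussian (h j) (S j)) = 0 := by
    have := integral_fun_snd (μ := Measure.pi fun j => multivariateGaussian (h j) (S j))
      (ν := multivariateGaussian 0 G.noiseCov) (fun w : State m => a ⬝ᵥ w.ofLp)
    rw [actionNoise, this, integral_dotProduct_multivariateGaussian]
    simp
  have e2 (j : Fin N) (c : Fin p → ℝ) : ∫ z : (Fin N → Control p) × State m, c ⬝ᵥ (z.1 j).ofLp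
      ∂(G.actionNoise fun j => multivariateGaussian (h j) (S j)) = c ⬝ᵥ (h j).ofLp := by
    have := integral_fun_fst (μ := Measure.pi fun j => multivariateGaussian (h j) (S j))
      (ν := multivariateGaussian 0 G.noiseCov) (fun u : Fin N → Control p => c ⬝ᵥ (u j).ofLp)
    rw [actionNoise, this, integral_comp_eval (X := fun _ : Fin N => Control p) (i := j)
      (f := fun u : Control p => c ⬝ᵥ u.ofLp)
      (memLp_dotProduct_multivariateGaussian c (h j)).1, integral_dotProduct_multivariateGaussian]
    simp
  rw [e1]
  simp [e2]

theorem integral_sq_dotProduct_rest (hS : ∀ j, (S j).PosSemidef) (a : Fin m → ℝ) :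
    ∫ z, (a ⬝ᵥ (G.rest i t x z).ofLp) ^ 2
        ∂(G.actionNoise fun j => multivariateGaussian (h j) (S j)) =
      (a ⬝ᵥ (G.rest i t x (h, 0)).ofLp) ^ 2
        + ∑ j ∈ Finset.univ.erase i, (a ᵥ* G.B j t) ⬝ᵥ (S j *ᵥ (a ᵥ* G.B j t))
        + a ⬝ᵥ (G.noiseCov *ᵥ a) := by
  have hv := variance_eq_sub
    (memLp_dotProduct_rest (G := G) (i := i) (t := t) (x := x) (S := S) h a)
  rw [integral_dotProduct_rest] at hv
  have hvar : Var[fun z => a ⬝ᵥ (G.rest i t x z).ofLp;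
      G.actionNoise fun j => multivariateGaussian (h j) (S j)] =
      ∑ j ∈ Finset.univ.erase i, (a ᵥ* G.B j t) ⬝ᵥ (S j *ᵥ (a ᵥ* G.B j t))
        + a ⬝ᵥ (G.noiseCov *ᵥ a) := by
    simp_rw [dotProduct_rest]
    have hj (j : Fin N) := memLp_dotProduct_multivariateGaussian (S := S j)
      (if j = i then 0 else (a ᵥ* G.B j t)) (h j)
    have hX : MemLp (fun u : Fin N → Control p =>
        ∑ j, (if j = i then 0 else (a ᵥ* G.B j t)) ⬝ᵥ (u j).ofLp) 2
        (Measure.pi fun j => multivariateGaussian (h j) (S j)) :=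
      memLp_finsetSum _ fun j _ => (hj j).comp_measurePreserving (measurePreserving_eval _ j)
    have h1 := variance_add_prod ((memLp_const (a ⬝ᵥ (G.A t *ᵥ x.ofLp))).add hX)
      (memLp_dotProduct_multivariateGaussian (S := G.noiseCov) a 0)
    have h2 := variance_const_add hX.1 (a ⬝ᵥ (G.A t *ᵥ x.ofLp))
    have h3 := variance_sum_pi hj
    have h4 : (∑ j, fun ω : Fin N → Control p =>
        (if j = i then 0 else (a ᵥ* G.B j t)) ⬝ᵥ (ω j).ofLp) =
        fun ω => ∑ j, (if j = i then 0 else (a ᵥ* G.B j t)) ⬝ᵥ (ω j).ofLp := by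
      ext ω; simp
    rw [h4] at h3
    refine h1.trans ?_
    rw [variance_dotProduct_multivariateGaussian _ _ G.noiseCov_posSemidef]
    congr 1
    refine h2.trans (h3.trans ?_)
    simp_rw [fun j => variance_dotProduct_multivariateGaussian
      (if j = i then 0 else (a ᵥ* G.B j t)) (h j) (hS j)]
    rw [← Finset.add_sum_erase _ _ (Finset.mem_univ i)]
    simp only [if_true, zero_dotProduct, zero_add]
    exact Finset.sum_congr rfl fun j hj => by rw [if_neg (Finset.ne_of_mem_erase hj)]
  rw [hvar] at hv
  simp only [Pi.pow_apply] at hv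
  linarith

theorem toEuclideanLin_apply_eq {a b : ℕ} (S : Matrix (Fin a) (Fin b) ℝ)
    (y : EuclideanSpace ℝ (Fin b)) (k : Fin a) : S.toEuclideanLin y k = S k ⬝ᵥ y.ofLp := rfl

theorem memLp_rest_of_gaussian {l : ℕ} (L : Matrix (Fin l) (Fin m) ℝ) :
    MemLp (fun z => L.toEuclideanLin (G.rest i t x z)) 2
      (G.actionNoise fun j => multivariateGaussian (h j) (S j)) := by
  refine MemLp.of_eval_piLp fun k => ?_
  simp only [toEuclideanLin_apply_eq]
  exact memLp_dotProduct_rest h (L k)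

theorem integral_rest_of_gaussian {l : ℕ} (L : Matrix (Fin l) (Fin m) ℝ) :
    ∫ z, L.toEuclideanLin (G.rest i t x z)
      ∂(G.actionNoise fun j => multivariateGaussian (h j) (S j)) =
      L.toEuclideanLin (G.rest i t x (h, 0)) := by
  ext k
  rw [eval_integral_piLp fun k =>
    ((memLp_rest_of_gaussian h L).eval_piLp k).integrable (by norm_num)]
  simp only [toEuclideanLin_apply_eq]
  exact integral_dotProduct_rest h (L k)

/-- The expected value of the quadratic form `P` at the contribution to the next state of the noise
and of the other agents' Gaussian actions. -/
theorem integral_norm_sq_rest_of_gaussian (hS : ∀ j, (S j).PosSemidef)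
    {P : Matrix (Fin m) (Fin m) ℝ} (hP : P.PosSemidef) :
    ∫ z, ‖(psdSqrt P).toEuclideanLin (G.rest i t x z)‖ ^ 2
      ∂(G.actionNoise fun j => multivariateGaussian (h j) (S j)) =
      quadForm P (G.rest i t x (h, 0)) + (G.noiseCov * P).trace
        + (∑ j ∈ Finset.univ.erase i, S j * (G.B j t)ᵀ * P * G.B j t).trace := by
  have htr (M : Matrix (Fin m) (Fin m) ℝ) :
      ∑ k, psdSqrt P k ⬝ᵥ (M *ᵥ psdSqrt P k) = (M * P).trace := by
    have : (M * P).trace = (psdSqrt P * M * (psdSqrt P)ᵀ).trace := by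
      rw [psdSqrt_transpose, Matrix.trace_mul_comm (psdSqrt P * M), ← Matrix.mul_assoc,
        psdSqrt_mul_self hP, Matrix.trace_mul_comm]
    rw [this, Matrix.trace]
    refine Finset.sum_congr rfl fun k _ => ?_
    rw [Matrix.diag_apply, Matrix.mul_apply, Matrix.dotProduct_mulVec]
    rfl
  have hB (j : Fin N) (a : Fin m → ℝ) : (a ᵥ* G.B j t) ⬝ᵥ (S j *ᵥ (a ᵥ* G.B j t)) =
      a ⬝ᵥ ((G.B j t * S j * (G.B j t)ᵀ) *ᵥ a) := by
    rw [← Matrix.dotProduct_mulVec, Matrix.mulVec_mulVec, ← Matrix.mulVec_transpose,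
      Matrix.mulVec_mulVec]
  simp only [EuclideanSpace.norm_sq_eq, Real.norm_eq_abs, sq_abs, toEuclideanLin_apply_eq]
  rw [integral_finsetSum _ fun k _ => (memLp_dotProduct_rest h (psdSqrt P k)).integrable_sq]
  simp_rw [integral_sq_dotProduct_rest h hS, hB]
  rw [Finset.sum_add_distrib, Finset.sum_add_distrib, Finset.sum_comm, htr, Matrix.trace_sum,
    Finset.sum_congr rfl fun j _ => htr (G.B j t * S j * (G.B j t)ᵀ), quadForm_eq_norm_sq hP,
    EuclideanSpace.norm_sq_eq]
  simp only [Real.norm_eq_abs, sq_abs, toEuclideanLin_apply_eq]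
  rw [add_right_comm]
  congr 1
  refine Finset.sum_congr rfl fun j _ => ?_
  rw [Matrix.mul_assoc, Matrix.mul_assoc, Matrix.trace_mul_comm]
  simp only [Matrix.mul_assoc]

variable {P : Fin N → ℕ → Matrix (Fin m) (Fin m) ℝ} {q : Fin N → ℕ → ℝ}
  {K : Fin N → ℕ → Matrix (Fin p) (Fin m) ℝ}

theorem linCoeff_of_gaussian (hP : (P i (t + 1)).PosSemidef) :
    G.linCoeff P i t x (fun j => multivariateGaussian (h j) (S j)) =
      ((G.B i t)ᵀ * P i (t + 1)) *ᵥ (G.rest i t x (h, 0)).ofLp := by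
  rw [linCoeff, integral_rest_of_gaussian, Matrix.ofLp_toLpLin, Matrix.toLin'_apply,
    Matrix.mulVec_mulVec (M := psdSqrt _), psdSqrt_mul_self hP, Matrix.mulVec_mulVec]

theorem rest_linear (x : State m) :
    (G.rest i t x ((fun j => (K j t).toEuclideanLin x), 0)).ofLp = G.othersA K i t *ᵥ x.ofLp := by
  rw [rest, othersA, Matrix.add_mulVec, Matrix.sum_mulVec]
  simp only [WithLp.ofLp_add, WithLp.ofLp_sum, Matrix.ofLp_toLpLin, Matrix.toLin'_apply,
    Matrix.mulVec_mulVec, add_zero]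

end LQGame

/-! ### The coupled Riccati equations -/

namespace LQGame

variable {N m p : ℕ} {G : LQGame N m p} {i : Fin N} {t : ℕ} {x : State m}
  {P : Fin N → ℕ → Matrix (Fin m) (Fin m) ℝ} {q : Fin N → ℕ → ℝ}
  {K : Fin N → ℕ → Matrix (Fin p) (Fin m) ℝ}

/-- The right-hand side of the Riccati equation for `P^i_t`. -/
noncomputable def riccatiRhs (G : LQGame N m p) (P : Fin N → ℕ → Matrix (Fin m) (Fin m) ℝ)
    (K : Fin N → ℕ → Matrix (Fin p) (Fin m) ℝ) (i : Fin N) (t : ℕ) : Matrix (Fin m) (Fin m) ℝ :=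
  G.Q i t + (G.othersA K i t)ᵀ * P i (t + 1) * G.othersA K i t
      - ((G.B i t)ᵀ * P i (t + 1) * G.othersA K i t)ᵀ * (G.regWeight P i t)⁻¹
        * ((G.B i t)ᵀ * P i (t + 1) * G.othersA K i t)

/-- The best response gain, as a function of the other agents' gains. -/
noncomputable def gainRhs (G : LQGame N m p) (P : Fin N → ℕ → Matrix (Fin m) (Fin m) ℝ)
    (K : Fin N → ℕ → Matrix (Fin p) (Fin m) ℝ) (i : Fin N) (t : ℕ) : Matrix (Fin p) (Fin m) ℝ :=
  -((G.regWeight P i t)⁻¹ * ((G.B i t)ᵀ * P i (t + 1) * G.othersA K i t))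

/-- The increment `q^i_t - q^i_{t+1}`. -/
noncomputable def offsetStep (G : LQGame N m p) (P : Fin N → ℕ → Matrix (Fin m) (Fin m) ℝ)
    (i : Fin N) (t : ℕ) : ℝ :=
  (G.noiseCov * P i (t + 1)).trace
      + (G.weight P i t * G.nashCov P i t).trace
      + G.τ / 2 * ((G.nashCov P i t).trace - p - Real.log (G.nashCov P i t).det)
      + (∑ j ∈ Finset.univ.erase i,
          G.nashCov P j t * (G.B j t)ᵀ * P i (t + 1) * G.B j t).trace

/-- Completing the square: the Riccati update preserves positive semidefiniteness. -/
theorem riccatiRhs_posSemidef (ht : t < G.T) (hP : (P i (t + 1)).PosSemidef) :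
    (G.riccatiRhs P K i t).PosSemidef := by
  set A := G.othersA K i t
  set B := G.B i t
  set P' := P i (t + 1)
  set D := G.regWeight P i t with hD
  set X := Bᵀ * P' * A with hX
  set L := -(D⁻¹ * X) with hL
  have hDpos : D.PosDef := regWeight_posDef ht hP
  have hPT : P'ᵀ = P' := hP.transpose_eq_self
  have hDiT : (D⁻¹)ᵀ = D⁻¹ := hDpos.inv.posSemidef.transpose_eq_self
  have hDD : D * D⁻¹ = 1 := Matrix.mul_nonsing_inv _ hDpos.det_pos.ne'.isUnit
  have hE : ((G.τ / 2) • (1 : Matrix (Fin p) (Fin p) ℝ) + G.R i t).PosSemidef :=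
    ((Matrix.PosDef.one.smul (half_pos G.τ_pos)).add_posSemidef
      (G.R_posDef i t ht).posSemidef).posSemidef
  have hDE : D = ((G.τ / 2) • (1 : Matrix (Fin p) (Fin p) ℝ) + G.R i t) + Bᵀ * P' * B := by
    rw [hD, regWeight, weight, add_assoc]
  have h1 : ((A + B * L)ᵀ * P' * (A + B * L)).PosSemidef := by
    have := hP.conjTranspose_mul_mul_same (A + B * L)
    rwa [Matrix.conjTranspose_eq_transpose_of_trivial] at this
  have h2 : (Lᵀ * ((G.τ / 2) • (1 : Matrix (Fin p) (Fin p) ℝ) + G.R i t) * L).PosSemidef := by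
    have := hE.conjTranspose_mul_mul_same L
    rwa [Matrix.conjTranspose_eq_transpose_of_trivial] at this
  have hXT : Xᵀ = Aᵀ * P' * B := by
    rw [hX, Matrix.transpose_mul, Matrix.transpose_mul, Matrix.transpose_transpose, hPT,
      Matrix.mul_assoc]
  have hLT : Lᵀ = -(Xᵀ * D⁻¹) := by
    rw [hL, Matrix.transpose_neg, Matrix.transpose_mul, hDiT]
  have hDL : D * L = -X := by
    rw [hL, Matrix.mul_neg, ← Matrix.mul_assoc, hDD, Matrix.one_mul]
  have key : G.riccatiRhs P K i t = G.Q i t + ((A + B * L)ᵀ * P' * (A + B * L)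
      + Lᵀ * ((G.τ / 2) • (1 : Matrix (Fin p) (Fin p) ℝ) + G.R i t) * L) := by
    have e1 : (A + B * L)ᵀ * P' * (A + B * L) = Aᵀ * P' * A + Xᵀ * L + Lᵀ * X
        + Lᵀ * (Bᵀ * P' * B) * L := by
      rw [hXT, hX, Matrix.transpose_add, Matrix.transpose_mul]
      simp only [Matrix.add_mul, Matrix.mul_add, Matrix.mul_assoc]
      abel
    have e2 : Lᵀ * (Bᵀ * P' * B) * L
        + Lᵀ * ((G.τ / 2) • (1 : Matrix (Fin p) (Fin p) ℝ) + G.R i t) * L = Lᵀ * (D * L) := by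
      rw [← Matrix.mul_assoc Lᵀ D L, hDE, Matrix.mul_add Lᵀ _ (Bᵀ * P' * B), Matrix.add_mul,
        add_comm]
    have e3 : Xᵀ * D⁻¹ * X = -(Xᵀ * L) := by
      rw [hL, Matrix.mul_neg, neg_neg, Matrix.mul_assoc]
    rw [e1, add_assoc (Aᵀ * P' * A + Xᵀ * L + Lᵀ * X), e2, hDL, Matrix.mul_neg Lᵀ X, riccatiRhs]
    change G.Q i t + Aᵀ * P' * A - Xᵀ * D⁻¹ * X = _
    rw [e3]
    abel
  rw [key]
  exact (G.Q_posSemidef i t ht.le).add (h1.add h2)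

/-- The expected control cost and the divergence from the prior of `N(0, Σ^i_t)` add up to a
logarithmic determinant. -/
theorem nashCov_identity (ht : t < G.T) (hP : (P i (t + 1)).PosSemidef) :
    (G.weight P i t * G.nashCov P i t).trace
      + G.τ / 2 * ((G.nashCov P i t).trace - p - Real.log (G.nashCov P i t).det) =
      G.τ / 2 * Real.log (1 + (2 / G.τ) • G.weight P i t).det := by
  have hτ := G.τ_pos
  have hM : (1 + (2 / G.τ) • G.weight P i t).PosDef :=
    Matrix.PosSemidef.one_add_posDef ((weight_posSemidef ht hP).smul (by positivity))
  have h1 : (1 + (2 / G.τ) • G.weight P i t) * G.nashCov P i t = 1 :=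
    Matrix.mul_nonsing_inv _ hM.det_pos.ne'.isUnit
  have h2 : (G.nashCov P i t).trace + 2 / G.τ * (G.weight P i t * G.nashCov P i t).trace = p := by
    have := congrArg Matrix.trace h1
    rw [Matrix.add_mul, Matrix.one_mul, Matrix.smul_mul, Matrix.trace_add, Matrix.trace_smul,
      Matrix.trace_one, Fintype.card_fin, smul_eq_mul] at this
    exact this
  have h3 : Real.log (G.nashCov P i t).det
      = -Real.log (1 + (2 / G.τ) • G.weight P i t).det := by
    rw [nashCov, Matrix.det_nonsing_inv, Ring.inverse_eq_inv', Real.log_inv]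
  have h4 : (G.weight P i t * G.nashCov P i t).trace =
      G.τ / 2 * (p - (G.nashCov P i t).trace) := by
    rw [← h2]; field_simp; ring
  rw [h3, h4]
  ring

/-- Against linear Gaussian policies, the cost of the best response is quadratic in the state, with
coefficients given by the Riccati equation. -/
theorem minCost_of_gaussian (ht : t < G.T) (hP : ∀ j, (P j (t + 1)).PosSemidef)
    (hPt : P i t = G.riccatiRhs P K i t) (hqt : q i t = q i (t + 1) + G.offsetStep P i t)
    (x : State m) :
    G.minCost P q i t x
      (fun j => multivariateGaussian ((K j t).toEuclideanLin x) (G.nashCov P j t)) =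
      quadForm (P i t) x + q i t := by
  have hDi := (regWeight_posDef ht (hP i)).inv.posSemidef
  rw [minCost, linCoeff_of_gaussian _ (hP i), integral_norm_sq_rest_of_gaussian _
    (fun j => nashCov_posSemidef ht (hP j)) (hP i), rest_linear, hPt, hqt, offsetStep,
    ← nashCov_identity ht (hP i)]
  have e1 : quadForm (P i (t + 1)) (G.rest i t x ((fun j => (K j t).toEuclideanLin x), 0)) =
      x.ofLp ⬝ᵥ (((G.othersA K i t)ᵀ * P i (t + 1) * G.othersA K i t) *ᵥ x.ofLp) := by
    rw [quadForm, rest_linear, Matrix.mul_assoc, ← Matrix.mulVec_mulVec,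
      Matrix.dotProduct_mulVec x.ofLp, Matrix.vecMul_transpose, Matrix.mulVec_mulVec]
  have e2 (X : Matrix (Fin p) (Fin m) ℝ) (D : Matrix (Fin p) (Fin p) ℝ) (v : Fin m → ℝ) :
      (X *ᵥ v) ⬝ᵥ (D *ᵥ (X *ᵥ v)) = v ⬝ᵥ ((Xᵀ * D * X) *ᵥ v) := by
    rw [Matrix.mul_assoc, ← Matrix.mulVec_mulVec, Matrix.dotProduct_mulVec v,
      Matrix.vecMul_transpose, Matrix.mulVec_mulVec]
  rw [e1, Matrix.mulVec_mulVec, e2, riccatiRhs, quadForm, quadForm, Matrix.sub_mulVec,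
    Matrix.add_mulVec, dotProduct_sub, dotProduct_add]
  ring

/-- Against linear Gaussian policies whose gains satisfy the gain equation for agent `i`, the policy
of agent `i` is the best response. -/
theorem bestResponse_of_gaussian (hP : (P i (t + 1)).PosSemidef)
    (hK : K i t = G.gainRhs P K i t) (x : State m) :
    G.bestResponse P i t x
      (fun j => multivariateGaussian ((K j t).toEuclideanLin x) (G.nashCov P j t)) =
      multivariateGaussian ((K i t).toEuclideanLin x) (G.nashCov P i t) := by
  rw [bestResponse, bestMean, linCoeff_of_gaussian _ hP, rest_linear, Matrix.mulVec_mulVec,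
    Matrix.mulVec_mulVec, ← Matrix.neg_mulVec]
  congr 1
  rw [hK, gainRhs, Matrix.mul_assoc]
  rfl

theorem quadForm_zero_right {n : ℕ} (M : Matrix (Fin n) (Fin n) ℝ) : quadForm M 0 = 0 := by
  simp [quadForm]

/-- The offset is the cost of the best response in the state zero, where all terms are
nonnegative. -/
theorem offset_nonneg (ht : t < G.T) (hP : ∀ j, (P j (t + 1)).PosSemidef)
    (hPt : P i t = G.riccatiRhs P K i t) (hqt : q i t = q i (t + 1) + G.offsetStep P i t)
    (hq : 0 ≤ q i (t + 1)) : 0 ≤ q i t := by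
  have h := minCost_of_gaussian ht hP hPt hqt 0
  rw [quadForm_zero_right, zero_add] at h
  have hτ := G.τ_pos
  have hlog := log_det_one_add_nonneg ((weight_posSemidef ht (hP i)).smul
    (show 0 ≤ 2 / G.τ by positivity))
  rw [← h, minCost, linCoeff_of_gaussian _ (hP i), rest_linear]
  simp only [quadForm_zero_right, WithLp.ofLp_zero, Matrix.mulVec_zero, dotProduct_zero]
  have : 0 ≤ ∫ z, ‖(psdSqrt (P i (t + 1))).toEuclideanLin (G.rest i t 0 z)‖ ^ 2
      ∂(G.actionNoise fun j => multivariateGaussian ((K j t).toEuclideanLin 0) (G.nashCov P j t)) :=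
    integral_nonneg fun z => by positivity
  have : 0 ≤ G.τ / 2 * Real.log (1 + (2 / G.τ) • G.weight P i t).det := by positivity
  linarith

end LQGame

/-! ### Dynamics -/

open InformationTheory in
/-- The divergence between two kernels is a measurable function of the parameter. -/
theorem measurable_klDiv_kernel {α β : Type*} [MeasurableSpace α] [MeasurableSpace β]
    [MeasurableSpace.CountablyGenerated β] (κ η : Kernel α β) [IsFiniteKernel κ]
    [IsFiniteKernel η] : Measurable fun a => klDiv (κ a) (η a) := by
  classical
  have h (a : α) : klDiv (κ a) (η a) = if κ a ≪ η a then
      ∫⁻ x, ENNReal.ofReal (klFun (κ.rnDeriv η a x).toReal) ∂(η a) else ∞ := by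
    split_ifs with hac
    · rw [klDiv_eq_lintegral_klFun_of_ac hac]
      refine lintegral_congr_ae ?_
      filter_upwards [Kernel.rnDeriv_eq_rnDeriv_measure (κ := κ) (η := η) (a := a)] with x hx
      rw [hx]
    · exact klDiv_of_not_ac hac
  simp_rw [h]
  refine Measurable.ite (Kernel.measurableSet_absolutelyContinuous κ η) ?_ measurable_const
  refine Measurable.lintegral_kernel_prod_right' (f := fun z : α × β =>
    ENNReal.ofReal (klFun (κ.rnDeriv η z.1 z.2).toReal)) ?_
  exact (measurable_klFun.comp (Kernel.measurable_rnDeriv κ η).ennreal_toReal).ennreal_ofReal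

theorem Hist.cur_own {N : ℕ} {X U : Type} (i : Fin N) {k : ℕ} (h : Hist X (Fin N → U) k) :
    (h.own i).cur = h.cur := by
  cases k <;> rfl

namespace LQGame

variable {N m p : ℕ} (G : LQGame N m p)

/-- The joint law of independent actions drawn from the kernels `κ j`, together with the noise. -/
noncomputable def actionNoiseKernel {α : Type} [MeasurableSpace α]
    (κ : Fin N → Kernel α (Control p)) [hκ : ∀ j, IsMarkovKernel (κ j)] :
    Kernel α ((Fin N → Control p) × State m) :=
  (⟨fun a => Measure.pi fun j => κ j a, measurable_pi_kernel κ hκ⟩ :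
    Kernel α (Fin N → Control p)) ×ₖ Kernel.const α (multivariateGaussian 0 G.noiseCov)

section Kernel

variable {α : Type} [MeasurableSpace α] (κ : Fin N → Kernel α (Control p))
  [hκ : ∀ j, IsMarkovKernel (κ j)]

theorem actionNoiseKernel_apply (a : α) :
    G.actionNoiseKernel κ a = G.actionNoise fun j => κ j a := by
  have : IsMarkovKernel (⟨fun a => Measure.pi fun j => κ j a, measurable_pi_kernel κ hκ⟩ :
      Kernel α (Fin N → Control p)) :=
    ⟨fun a => (inferInstance : IsProbabilityMeasure (Measure.pi fun j => κ j a))⟩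
  rw [actionNoiseKernel, Kernel.prod_apply, Kernel.const_apply]
  rfl

instance : IsMarkovKernel (G.actionNoiseKernel κ) :=
  ⟨fun a => by rw [actionNoiseKernel_apply]; infer_instance⟩

theorem measurable_lintegral_next (t : ℕ) {c : α → State m} (hc : Measurable c)
    {f : State m → ℝ≥0∞} (hf : Measurable f) :
    Measurable fun a => ∫⁻ y, f y ∂(G.next t (c a) fun j => κ j a) := by
  have h (a : α) : ∫⁻ y, f y ∂(G.next t (c a) fun j => κ j a) =
      ∫⁻ z, f (G.drift t (c a) z.1 + z.2) ∂(G.actionNoiseKernel κ a) := by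
    rw [next, lintegral_map hf (G.measurable_drift_add t _), actionNoiseKernel_apply]
  simp_rw [h]
  refine Measurable.lintegral_kernel_prod_right'
    (f := fun w : α × ((Fin N → Control p) × State m) => f (G.drift t (c w.1) w.2.1 + w.2.2)) ?_
  exact hf.comp (G.measurable_drift_add_uncurry t hc)

theorem measurable_stage (i : Fin N) (t : ℕ) {c : α → State m} (hc : Measurable c)
    (η : Kernel α (Control p)) [IsMarkovKernel η] :
    Measurable fun a => G.stage i t (c a) (η a) := by
  have := G.prior_markov i t
  have h1 : Measurable fun a => ENNReal.ofReal (quadForm (G.Q i t) (c a)) :=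
    ((continuous_quadForm _).measurable.comp hc).ennreal_ofReal
  have h2 : Measurable fun a => ∫⁻ u, ENNReal.ofReal (quadForm (G.R i t) u) ∂(η a) :=
    (continuous_quadForm _).measurable.ennreal_ofReal.lintegral_kernel
  exact (h1.add h2).add ((measurable_klDiv_kernel η ((G.prior i t).comap c hc)).const_mul _)

/-- The mean of the best response depends measurably on the state. -/
theorem measurable_bestMean (P : Fin N → ℕ → Matrix (Fin m) (Fin m) ℝ) (i : Fin N) (t : ℕ)
    {c : α → State m} (hc : Measurable c) :
    Measurable fun a => G.bestMean P i t (c a) fun j => κ j a := by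
  have h1 : Measurable fun a => ∫ z, (psdSqrt (P i (t + 1))).toEuclideanLin (G.rest i t (c a) z)
      ∂(G.actionNoise fun j => κ j a) := by
    simp_rw [← G.actionNoiseKernel_apply κ]
    refine (StronglyMeasurable.integral_kernel_prod_right (κ := G.actionNoiseKernel κ)
      (f := fun a z => (psdSqrt (P i (t + 1))).toEuclideanLin (G.rest i t (c a) z)) ?_).measurable
    refine Measurable.stronglyMeasurable ?_
    exact (continuous_toEuclideanLin _).measurable.comp (G.measurable_rest_uncurry i t hc)
  have h2 : Continuous fun v : State m => (WithLp.toLp 2 (-((G.regWeight P i t)⁻¹ *ᵥ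
      ((G.B i t)ᵀ *ᵥ (psdSqrt (P i (t + 1)) *ᵥ v.ofLp)))) : Control p) := by
    unfold Matrix.mulVec dotProduct
    fun_prop
  exact h2.measurable.comp h1

end Kernel

/-- The Gaussian kernel with a measurable mean. -/
noncomputable def meanGaussKernel {α : Type*} [MeasurableSpace α] {c : α → Control p}
    (hc : Measurable c) (S : Matrix (Fin p) (Fin p) ℝ) : Kernel α (Control p) where
  toFun a := multivariateGaussian (c a) S
  measurable' := by
    refine Measure.measurable_of_measurable_coe _ fun s hs => ?_
    have hf (L : Control p →L[ℝ] Control p) :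
        Measurable fun z : α × Control p => c z.1 + L z.2 :=
      (hc.comp measurable_fst).add (L.continuous.measurable.comp measurable_snd)
    have hg (L : Control p →L[ℝ] Control p) : Measurable fun a : α =>
        (stdGaussian (Control p)).map (fun u => c a + L u) s := by
      convert measurable_measure_prodMk_left (ν := stdGaussian (Control p)) (hf L hs) using 2 with a
      exact Measure.map_apply ((hf L).comp (measurable_prodMk_left (x := a))) hs
    exact hg _

section Law

variable (s : ℕ) (σ : Fin N → Policy m p) (x : State m)

/-- The action laws of the agents given the history. -/
def actionLaws (σ : Fin N → Policy m p) (k : ℕ) (h : Hist (State m) (Fin N → Control p) k) :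
    Fin N → Measure (Control p) :=
  fun j => (σ j).ker k (h.own j)

instance (σ : Fin N → Policy m p) (k : ℕ) (h : Hist (State m) (Fin N → Control p) k) (j : Fin N) :
    IsProbabilityMeasure (actionLaws σ k h j) :=
  ((σ j).markov k).isProbabilityMeasure _

theorem lintegral_law_succ (k : ℕ)
    {F : Hist (State m) (Fin N → Control p) k × ((Fin N → Control p) × State m) → ℝ≥0∞}
    (hF : Measurable F) :
    ∫⁻ h, F h ∂(G.law s σ x (k + 1)) = ∫⁻ h, ∫⁻ z, F (h, (z.1, G.drift (s + k) h.cur z.1 + z.2))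
      ∂(G.actionNoise (actionLaws σ k h)) ∂(G.law s σ x k) := by
  have hprob := G.isProbabilityMeasure_law s σ x k
  have hn := G.measurable_next (s + k) k
  have hFn : Measurable fun z : (Hist (State m) (Fin N → Control p) k × (Fin N → Control p))
      × State m => F (z.1.1, (z.1.2, G.drift (s + k) z.1.1.cur z.1.2 + z.2)) := hF.comp hn
  calc ∫⁻ h, F h ∂(G.law s σ x (k + 1))
      = ∫⁻ z, F (z.1.1, (z.1.2, G.drift (s + k) z.1.1.cur z.1.2 + z.2))
          ∂((G.law s σ x k ⊗ₘ jointAction σ k).prod (multivariateGaussian 0 G.noiseCov)) :=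
        lintegral_map hF hn
    _ = _ := by
        rw [lintegral_prod _ hFn.aemeasurable,
          Measure.lintegral_compProd hFn.lintegral_prod_right']
        refine lintegral_congr fun h => ?_
        have hm : Measurable fun z : (Fin N → Control p) × State m =>
            F (h, (z.1, G.drift (s + k) h.cur z.1 + z.2)) :=
          hF.comp (measurable_const.prodMk
            (measurable_fst.prodMk (G.measurable_drift_add (s + k) h.cur)))
        rw [actionNoise, lintegral_prod _ hm.aemeasurable]
        rfl

theorem lintegral_law_succ_cur (k : ℕ) {f : State m → ℝ≥0∞} (hf : Measurable f) :
    ∫⁻ h, f h.cur ∂(G.law s σ x (k + 1)) =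
      ∫⁻ h, ∫⁻ y, f y ∂(G.next (s + k) h.cur (actionLaws σ k h)) ∂(G.law s σ x k) := by
  have := G.lintegral_law_succ s σ x k (F := fun h => f h.2.2)
    (hf.comp (measurable_snd.comp measurable_snd))
  refine this.trans (lintegral_congr fun h => ?_)
  rw [next, lintegral_map hf (G.measurable_drift_add _ _)]

theorem lintegral_law_zero {f : State m → ℝ≥0∞} (hf : Measurable f) :
    ∫⁻ h, f h.cur ∂(G.law s σ x 0) = f x :=
  lintegral_dirac' (α := State m) x hf

/-- The expectation of a realized stage cost, conditional on the history, is `stage`. -/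
theorem lintegral_stage (i : Fin N) (k : ℕ) :
    ∫⁻ h : Hist (State m) (Fin N → Control p) (k + 1),
      (ENNReal.ofReal (quadForm (G.Q i (s + k)) h.1.cur)
        + ENNReal.ofReal (quadForm (G.R i (s + k)) (h.2.1 i))
        + ENNReal.ofReal G.τ *
          InformationTheory.klDiv ((σ i).ker k (h.1.own i))
            (G.prior i (s + k) h.1.cur))
      ∂(G.law s σ x (k + 1)) =
    ∫⁻ h, G.stage i (s + k) h.cur (actionLaws σ k h i) ∂(G.law s σ x k) := by
  have := G.prior_markov i (s + k)
  have := (σ i).markov k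
  have hcur := Hist.measurable_cur (X := State m) (U := Fin N → Control p) k
  have hkl : Measurable fun h : Hist (State m) (Fin N → Control p) k =>
      InformationTheory.klDiv ((σ i).ker k (h.own i)) (G.prior i (s + k) h.cur) :=
    measurable_klDiv_kernel (((σ i).ker k).comap _ (Hist.measurable_own i k))
      ((G.prior i (s + k)).comap _ hcur)
  have hR : Measurable fun u : Control p => ENNReal.ofReal (quadForm (G.R i (s + k)) u) :=
    (continuous_quadForm _).measurable.ennreal_ofReal
  have hQ : Measurable fun u : State m => ENNReal.ofReal (quadForm (G.Q i (s + k)) u) :=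
    (continuous_quadForm _).measurable.ennreal_ofReal
  refine (G.lintegral_law_succ s σ x k (F := fun h =>
    (ENNReal.ofReal (quadForm (G.Q i (s + k)) h.1.cur)
        + ENNReal.ofReal (quadForm (G.R i (s + k)) (h.2.1 i))
        + ENNReal.ofReal G.τ *
          InformationTheory.klDiv ((σ i).ker k (h.1.own i))
            (G.prior i (s + k) h.1.cur))) ?_).trans ?_
  · refine ((hQ.comp (hcur.comp measurable_fst)).add (hR.comp ?_)).add
      ((hkl.comp measurable_fst).const_mul _)
    exact (measurable_pi_apply i).comp (measurable_fst.comp measurable_snd)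
  · refine lintegral_congr fun h => ?_
    have hRi : Measurable fun z : (Fin N → Control p) × State m =>
        ENNReal.ofReal (quadForm (G.R i (s + k)) (z.1 i)) :=
      hR.comp ((measurable_pi_apply i).comp measurable_fst)
    dsimp only
    rw [lintegral_add_right _ measurable_const, lintegral_add_left measurable_const,
      lintegral_const, lintegral_const, measure_univ, mul_one, mul_one, stage]
    congr 2
    have hmp : MeasurePreserving (fun z : (Fin N → Control p) × State m => z.1 i)
        (G.actionNoise (actionLaws σ k h)) (actionLaws σ k h i) :=
      (measurePreserving_eval _ i).comp measurePreserving_fst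
    exact hmp.lintegral_comp hR

theorem cost_eq (i : Fin N) :
    G.cost i s σ x = ∑ k ∈ Finset.range (G.T - s),
      ∫⁻ h, G.stage i (s + k) h.cur (actionLaws σ k h i) ∂(G.law s σ x k)
      + ∫⁻ h, ENNReal.ofReal (quadForm (G.Q i G.T) h.cur) ∂(G.law s σ x (G.T - s)) := by
  rw [cost]
  congr 1
  exact Finset.sum_congr rfl fun k _ => G.lintegral_stage s σ x i k

end Law

end LQGame

/-! ### Feedback policies and the Bellman equation -/

/-- The action laws of a profile of feedback policies at time `t` in the state `x`. -/
def feedbackLaws {N m p : ℕ} (π : Fin N → FeedbackPolicy m p) (t : ℕ) (x : State m) :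
    Fin N → Measure (Control p) :=
  fun j => (π j).ker t x

instance {N m p : ℕ} (π : Fin N → FeedbackPolicy m p) (t : ℕ) (x : State m) (j : Fin N) :
    IsProbabilityMeasure (feedbackLaws π t x j) :=
  ((π j).markov t).isProbabilityMeasure x

theorem liftProfile_congr {N m p : ℕ} {π π' : Fin N → FeedbackPolicy m p} {t : ℕ}
    (h : ∀ j k, (π j).ker (t + k) = (π' j).ker (t + k)) : liftProfile π t = liftProfile π' t := by
  funext j
  simp only [liftProfile, FeedbackPolicy.lift, h j]

namespace LQGame

variable {N m p : ℕ} (G : LQGame N m p) (π : Fin N → FeedbackPolicy m p)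

theorem actionLaws_liftProfile (s k : ℕ) (h : Hist (State m) (Fin N → Control p) k) :
    actionLaws (liftProfile π s) k h = feedbackLaws π (s + k) h.cur := by
  funext j
  change (π j).ker (s + k) (h.own j).cur = _
  rw [Hist.cur_own]
  rfl

theorem law_congr {π π' : Fin N → FeedbackPolicy m p} {s : ℕ} (x : State m) (k : ℕ)
    (h : ∀ j l, l < k → (π j).ker (s + l) = (π' j).ker (s + l)) :
    G.law s (liftProfile π s) x k = G.law s (liftProfile π' s) x k := by
  induction k with
  | zero => rfl
  | succ k ih =>
    have hJ : jointAction (liftProfile π s) k = jointAction (liftProfile π' s) k := by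
      ext1 y
      change Measure.pi (actionLaws (liftProfile π s) k y)
        = Measure.pi (actionLaws (liftProfile π' s) k y)
      rw [actionLaws_liftProfile, actionLaws_liftProfile]
      congr 1
      funext j
      simp only [feedbackLaws, h j k (Nat.lt_succ_self k)]
    rw [law, law, ih fun j l hl => h j l (Nat.lt_succ_of_lt hl), hJ]

theorem measurable_lintegral_next_feedback (t : ℕ) {f : State m → ℝ≥0∞} (hf : Measurable f) :
    Measurable fun x => ∫⁻ y, f y ∂(G.next t x (feedbackLaws π t x)) :=
  G.measurable_lintegral_next (fun j => (π j).ker t) (hκ := fun j => (π j).markov t) t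
    measurable_id hf

theorem measurable_stage_feedback (i : Fin N) (t : ℕ) :
    Measurable fun x => G.stage i t x (feedbackLaws π t x i) := by
  have := (π i).markov t
  exact G.measurable_stage i t measurable_id ((π i).ker t)

theorem lintegral_law_feedback_succ (s : ℕ) (x : State m) (k : ℕ) {f : State m → ℝ≥0∞}
    (hf : Measurable f) :
    ∫⁻ h, f h.cur ∂(G.law s (liftProfile π s) x (k + 1)) =
      ∫⁻ h, ∫⁻ y, f y ∂(G.next (s + k) h.cur (feedbackLaws π (s + k) h.cur))
        ∂(G.law s (liftProfile π s) x k) := by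
  rw [G.lintegral_law_succ_cur s _ x k hf]
  simp_rw [actionLaws_liftProfile]

/-- The Markov property: conditioning on the state after the first step. -/
theorem lintegral_law_feedback_first_step (s : ℕ) (x : State m) (k : ℕ) {f : State m → ℝ≥0∞}
    (hf : Measurable f) :
    ∫⁻ h, f h.cur ∂(G.law s (liftProfile π s) x (k + 1)) =
      ∫⁻ y, ∫⁻ h, f h.cur ∂(G.law (s + 1) (liftProfile π (s + 1)) y k)
        ∂(G.next s x (feedbackLaws π s x)) := by
  induction k generalizing f with
  | zero =>
    rw [G.lintegral_law_feedback_succ π s x 0 hf]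
    rw [G.lintegral_law_zero s _ x (G.measurable_lintegral_next_feedback π (s + 0) hf)]
    exact lintegral_congr fun y => (G.lintegral_law_zero (s + 1) _ y hf).symm
  | succ k ih =>
    rw [G.lintegral_law_feedback_succ π s x (k + 1) hf,
      ih (G.measurable_lintegral_next_feedback π (s + (k + 1)) hf)]
    refine lintegral_congr fun y => ?_
    rw [G.lintegral_law_feedback_succ π (s + 1) y k hf]
    have : s + (k + 1) = s + 1 + k := by ring
    rw [this]

theorem cost_feedback_eq (i : Fin N) (s : ℕ) (x : State m) :
    G.cost i s (liftProfile π s) x = ∑ k ∈ Finset.range (G.T - s),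
      ∫⁻ h, G.stage i (s + k) h.cur (feedbackLaws π (s + k) h.cur i)
        ∂(G.law s (liftProfile π s) x k)
      + ∫⁻ h, ENNReal.ofReal (quadForm (G.Q i G.T) h.cur)
        ∂(G.law s (liftProfile π s) x (G.T - s)) := by
  rw [G.cost_eq]
  simp_rw [actionLaws_liftProfile]

theorem measurable_lintegral_law_feedback (s k : ℕ) {f : State m → ℝ≥0∞} (hf : Measurable f) :
    Measurable fun x => ∫⁻ h, f h.cur ∂(G.law s (liftProfile π s) x k) := by
  induction k generalizing f with
  | zero => simpa only [G.lintegral_law_zero s _ _ hf] using hf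
  | succ k ih =>
    simp_rw [G.lintegral_law_feedback_succ π s _ k hf]
    exact ih (G.measurable_lintegral_next_feedback π (s + k) hf)

theorem measurable_quadForm_ofReal {n : ℕ} (M : Matrix (Fin n) (Fin n) ℝ) :
    Measurable fun x : EuclideanSpace ℝ (Fin n) => ENNReal.ofReal (quadForm M x) :=
  (continuous_quadForm M).measurable.ennreal_ofReal

theorem measurable_cost_feedback (i : Fin N) (s : ℕ) :
    Measurable fun x => G.cost i s (liftProfile π s) x := by
  simp_rw [cost_feedback_eq]
  refine Measurable.add (Finset.measurable_sum _ fun k _ => ?_) ?_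
  · exact G.measurable_lintegral_law_feedback π s k (G.measurable_stage_feedback π i (s + k))
  · exact G.measurable_lintegral_law_feedback π s _ (measurable_quadForm_ofReal _)

theorem cost_feedback_terminal (i : Fin N) (x : State m) :
    G.cost i G.T (liftProfile π G.T) x = ENNReal.ofReal (quadForm (G.Q i G.T) x) := by
  rw [cost_feedback_eq, Nat.sub_self, Finset.range_zero, Finset.sum_empty, zero_add,
    G.lintegral_law_zero _ _ x (measurable_quadForm_ofReal _)]

/-- The Bellman equation for a profile of feedback policies. -/
theorem cost_feedback_step (i : Fin N) {s : ℕ} (hs : s < G.T) (x : State m) :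
    G.cost i s (liftProfile π s) x = G.stage i s x (feedbackLaws π s x i)
      + ∫⁻ y, G.cost i (s + 1) (liftProfile π (s + 1)) y ∂(G.next s x (feedbackLaws π s x)) := by
  have hT : G.T - s = (G.T - (s + 1)) + 1 := by omega
  have hm (k : ℕ) := G.measurable_stage_feedback π i k
  simp_rw [cost_feedback_eq]
  rw [hT, Finset.sum_range_succ', G.lintegral_law_zero s _ x (hm (s + 0)),
    G.lintegral_law_feedback_first_step π s x _ (measurable_quadForm_ofReal _),
    lintegral_add_right _
      (G.measurable_lintegral_law_feedback π _ _ (measurable_quadForm_ofReal _)),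
    lintegral_finsetSum _ fun k _ => G.measurable_lintegral_law_feedback π (s + 1) k
      (hm (s + 1 + k)), add_comm (∑ k ∈ _, _) (G.stage i _ x _), add_assoc]
  congr 2
  refine Finset.sum_congr rfl fun k _ => ?_
  rw [G.lintegral_law_feedback_first_step π s x k (hm (s + (k + 1)))]
  have : s + (k + 1) = s + 1 + k := by ring
  rw [this]

/-- The cost, split at an intermediate time. -/
theorem cost_feedback_split (i : Fin N) (s k : ℕ) (hk : s + k ≤ G.T) (x : State m) :
    G.cost i s (liftProfile π s) x = ∑ l ∈ Finset.range k,
      ∫⁻ h, G.stage i (s + l) h.cur (feedbackLaws π (s + l) h.cur i)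
        ∂(G.law s (liftProfile π s) x l)
      + ∫⁻ h, G.cost i (s + k) (liftProfile π (s + k)) h.cur
        ∂(G.law s (liftProfile π s) x k) := by
  induction k with
  | zero =>
    rw [Finset.range_zero, Finset.sum_empty, zero_add,
      G.lintegral_law_zero s _ x (G.measurable_cost_feedback π i (s + 0)), Nat.add_zero]
  | succ k ih =>
    have hm := G.measurable_stage_feedback π i (s + k)
    have hcur := Hist.measurable_cur (X := State m) (U := Fin N → Control p) k
    have hmc : Measurable fun h : Hist (State m) (Fin N → Control p) k =>
        G.stage i (s + k) h.cur (feedbackLaws π (s + k) h.cur i) := hm.comp hcur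
    rw [ih (by omega), Finset.sum_range_succ, add_assoc]
    congr 1
    rw [G.lintegral_law_feedback_succ π s x k (G.measurable_cost_feedback π i (s + (k + 1))),
      ← lintegral_add_left hmc]
    refine lintegral_congr fun h => ?_
    exact G.cost_feedback_step π i (by omega) h.cur

end LQGame

/-! ### Solutions of the Riccati equations are equilibria -/

namespace LQGame

variable {N m p : ℕ} {G : LQGame N m p}
  {P : Fin N → ℕ → Matrix (Fin m) (Fin m) ℝ} {q : Fin N → ℕ → ℝ}
  {K : Fin N → ℕ → Matrix (Fin p) (Fin m) ℝ}

theorem IsRiccatiFrom.posSemidef {s : ℕ} (h : G.IsRiccatiFrom s P K) {t : ℕ} (hst : s ≤ t)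
    (ht : t ≤ G.T) (i : Fin N) : (P i t).PosSemidef := by
  induction ht using Nat.decreasingInduction with
  | self => rw [h.terminal]; exact G.Q_posSemidef i G.T le_rfl
  | of_succ t ht ih =>
    rw [h.riccati i t hst ht]
    exact riccatiRhs_posSemidef ht (ih (by omega))

theorem IsOffset.step_eq (hq : G.IsOffset P q) (i : Fin N) {t : ℕ} (ht : t < G.T) :
    q i t = q i (t + 1) + G.offsetStep P i t := by
  rw [hq.step i t ht, offsetStep]; ring

theorem IsRiccatiFrom.offset_nonneg {s : ℕ} (h : G.IsRiccatiFrom s P K) (hq : G.IsOffset P q)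
    {t : ℕ} (hst : s ≤ t) (ht : t ≤ G.T) (i : Fin N) : 0 ≤ q i t := by
  induction ht using Nat.decreasingInduction with
  | self => rw [hq.terminal]
  | of_succ t ht ih =>
    exact LQGame.offset_nonneg ht (fun j => h.posSemidef (by omega) ht j) (h.riccati i t hst ht)
      (hq.step_eq i ht) (ih (by omega))

/-- The action laws of the linear Gaussian policies. -/
theorem feedbackLaws_gaussPolicy (t : ℕ) (x : State m) :
    feedbackLaws (G.gaussPolicy P K) t x =
      fun j => multivariateGaussian ((K j t).toEuclideanLin x) (G.nashCov P j t) := rfl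

section OneStep

variable {i : Fin N} {t : ℕ} {x : State m} (ht : t < G.T)
  (hprior : G.prior i t x = stdGaussian (Control p))
  (hP : ∀ j, (P j (t + 1)).PosSemidef) (hq : 0 ≤ q i (t + 1))
  (hPt : P i t = G.riccatiRhs P K i t) (hqt : q i t = q i (t + 1) + G.offsetStep P i t)

include ht hprior hP hq hPt hqt

/-- One step of the verification argument: no action law of agent `i` improves on the candidate
value. -/
theorem quadValue_le_of_gaussian (μ : Measure (Control p)) [IsProbabilityMeasure μ] :
    quadValue P q i t x ≤ G.stage i t x μ + ∫⁻ y, quadValue P q i (t + 1) y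
      ∂(G.next t x (Function.update (feedbackLaws (G.gaussPolicy P K) t x) i μ)) := by
  by_cases hfin : G.stage i t x μ + ∫⁻ y, quadValue P q i (t + 1) y
      ∂(G.next t x (Function.update (feedbackLaws (G.gaussPolicy P K) t x) i μ)) = ∞
  · rw [hfin]; exact le_top
  · have hL := memLp_rest_of_gaussian (G := G) (i := i) (t := t) (x := x)
      (S := fun j => G.nashCov P j t) (fun j => (K j t).toEuclideanLin x) (psdSqrt (P i (t + 1)))
    rw [(stage_add_next_eq_klDiv (ν := feedbackLaws (G.gaussPolicy P K) t x) ht hprior (hP i) hq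
      hL).1 μ inferInstance hfin, feedbackLaws_gaussPolicy, minCost_of_gaussian ht hP hPt hqt x,
      ← quadValue]
    exact le_add_self

/-- The Bellman equation for the candidate value. -/
theorem quadValue_eq_of_gaussian (hK : K i t = G.gainRhs P K i t) :
    G.stage i t x (feedbackLaws (G.gaussPolicy P K) t x i) + ∫⁻ y, quadValue P q i (t + 1) y
      ∂(G.next t x (feedbackLaws (G.gaussPolicy P K) t x)) = quadValue P q i t x := by
  have hL := memLp_rest_of_gaussian (G := G) (i := i) (t := t) (x := x)
      (S := fun j => G.nashCov P j t) (fun j => (K j t).toEuclideanLin x) (psdSqrt (P i (t + 1)))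
  have h := (stage_add_next_eq_klDiv (ν := feedbackLaws (G.gaussPolicy P K) t x) ht hprior (hP i)
    hq hL).2
  have hbr : G.bestResponse P i t x (feedbackLaws (G.gaussPolicy P K) t x) =
      feedbackLaws (G.gaussPolicy P K) t x i := by
    rw [feedbackLaws_gaussPolicy, bestResponse_of_gaussian (hP i) hK x]
  rw [hbr, Function.update_eq_self] at h
  rw [h, feedbackLaws_gaussPolicy, minCost_of_gaussian ht hP hPt hqt x, ← quadValue]

end OneStep

variable (hprior : ∀ i t, t < G.T → ∀ x, G.prior i t x = stdGaussian (Control p))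
  (hR : G.IsRiccatiFrom 0 P K) (hq : G.IsOffset P q)

include hprior hR hq

theorem cost_gaussPolicy (i : Fin N) {t : ℕ} (ht : t ≤ G.T) (x : State m) :
    G.cost i t (liftProfile (G.gaussPolicy P K) t) x = quadValue P q i t x := by
  induction ht using Nat.decreasingInduction generalizing x with
  | self => rw [cost_feedback_terminal, quadValue, hR.terminal, hq.terminal, add_zero]
  | of_succ t ht ih =>
    rw [cost_feedback_step _ _ _ ht, lintegral_congr ih]
    exact quadValue_eq_of_gaussian ht (hprior i t ht x) (fun j => hR.posSemidef (by omega) ht j)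
      (hR.offset_nonneg hq (by omega) ht i) (hR.riccati i t (by omega) ht) (hq.step_eq i ht)
      (hR.gain i t (by omega) ht)

/-- A unilateral deviation, over the first `k` steps and to an arbitrary policy, does not lower the
cost, when the candidate value function is charged for the remaining steps. -/
theorem quadValue_le_deviation (i : Fin N) (s : ℕ) (ρ : Policy m p) (x : State m) (k : ℕ)
    (hk : s + k ≤ G.T) :
    letI σ := Function.update (liftProfile (G.gaussPolicy P K) s) i ρ
    quadValue P q i s x ≤ ∑ l ∈ Finset.range k,
      ∫⁻ h, G.stage i (s + l) h.cur (actionLaws σ l h i) ∂(G.law s σ x l)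
      + ∫⁻ h, quadValue P q i (s + k) h.cur ∂(G.law s σ x k) := by
  set σ := Function.update (liftProfile (G.gaussPolicy P K) s) i ρ with hσ
  induction k with
  | zero =>
    rw [Finset.range_zero, Finset.sum_empty, zero_add,
      G.lintegral_law_zero s _ x (measurable_quadValue P q i (s + 0)), Nat.add_zero]
  | succ k ih =>
    refine (ih (by omega)).trans ?_
    rw [Finset.sum_range_succ, add_assoc]
    gcongr
    have hmark := (σ i).markov k
    have hm : Measurable fun h : Hist (State m) (Fin N → Control p) k =>
        G.stage i (s + k) h.cur (actionLaws σ k h i) :=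
      G.measurable_stage i (s + k) (Hist.measurable_cur k)
        (((σ i).ker k).comap _ (Hist.measurable_own i k))
    rw [G.lintegral_law_succ_cur s σ x k (measurable_quadValue P q i (s + (k + 1))),
      ← lintegral_add_left hm]
    refine lintegral_mono fun h => ?_
    have ht : s + k < G.T := by omega
    have hlaws : actionLaws σ k h = Function.update
        (feedbackLaws (G.gaussPolicy P K) (s + k) h.cur) i (actionLaws σ k h i) := by
      funext j
      by_cases hj : j = i
      · subst hj; simp
      · rw [Function.update_of_ne hj, ← actionLaws_liftProfile]
        simp only [actionLaws, hσ, Function.update_of_ne hj]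
    have := quadValue_le_of_gaussian (x := h.cur) ht (hprior i _ ht h.cur)
      (fun j => hR.posSemidef (by omega) ht j)
      (hR.offset_nonneg hq (by omega) ht i) (hR.riccati i _ (by omega) ht) (hq.step_eq i ht)
      (actionLaws σ k h i)
    rw [← hlaws] at this
    exact this

theorem isNash_gaussPolicy {s : ℕ} (hs : s ≤ G.T) :
    G.IsNash s (liftProfile (G.gaussPolicy P K) s) := by
  intro x i
  rw [cost_gaussPolicy hprior hR hq i hs x]
  refine ⟨ENNReal.ofReal_ne_top, fun ρ => ?_⟩
  have h := quadValue_le_deviation hprior hR hq i s ρ x (G.T - s) (by omega)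
  rw [G.cost_eq]
  convert h using 4 with h'
  rw [quadValue, show s + (G.T - s) = G.T by omega, hR.terminal, hq.terminal, add_zero]

end LQGame

theorem LQGame.hasQuadValue_of_cost_eq {N m p : ℕ} {G : LQGame N m p}
    {P : Fin N → ℕ → Matrix (Fin m) (Fin m) ℝ} {q : Fin N → ℕ → ℝ}
    {π : Fin N → FeedbackPolicy m p} {t : ℕ} {x : State m}
    (hP : ∀ i, (P i t).PosSemidef) (hq : ∀ i, 0 ≤ q i t)
    (h : ∀ i, G.cost i t (liftProfile π t) x = LQGame.quadValue P q i t x) :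
    G.HasQuadValue P q π t x := fun i => by
  rw [h i, LQGame.quadValue]
  exact ⟨ENNReal.ofReal_ne_top,
    ENNReal.toReal_ofReal (add_nonneg (quadForm_nonneg (hP i) x) (hq i))⟩

/-! ### Equilibria play best responses -/

namespace LQGame

variable {N m p : ℕ} {G : LQGame N m p}
  {P : Fin N → ℕ → Matrix (Fin m) (Fin m) ℝ} {q : Fin N → ℕ → ℝ}
  {K : Fin N → ℕ → Matrix (Fin p) (Fin m) ℝ} {π : Fin N → FeedbackPolicy m p}

/-- The kernel of best responses of agent `i` to the other agents' feedback policies. -/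
noncomputable def bestResponseKernel (G : LQGame N m p)
    (P : Fin N → ℕ → Matrix (Fin m) (Fin m) ℝ) (π : Fin N → FeedbackPolicy m p) (i : Fin N)
    (t : ℕ) : Kernel (State m) (Control p) :=
  meanGaussKernel (c := fun x => G.bestMean P i t x (feedbackLaws π t x))
    (G.measurable_bestMean (fun j => (π j).ker t) (hκ := fun j => (π j).markov t) P i t
      measurable_id) (G.nashCov P i t)

theorem bestResponseKernel_apply (i : Fin N) (t : ℕ) (x : State m) :
    G.bestResponseKernel P π i t x = G.bestResponse P i t x (feedbackLaws π t x) := rfl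

/-- The policy of agent `i` that deviates from `π i` at time `t` only, to the best response. -/
noncomputable def deviation (G : LQGame N m p) (P : Fin N → ℕ → Matrix (Fin m) (Fin m) ℝ)
    (π : Fin N → FeedbackPolicy m p) (i : Fin N) (t : ℕ) : FeedbackPolicy m p where
  ker := Function.update (π i).ker t (G.bestResponseKernel P π i t)
  markov t' := by
    by_cases h : t' = t
    · subst h
      rw [Function.update_self]
      exact ⟨fun x => by rw [bestResponseKernel_apply]; infer_instance⟩
    · rw [Function.update_of_ne h]
      exact (π i).markov t'

theorem deviation_ker_of_ne (i j : Fin N) {t t' : ℕ} (h : t' ≠ t) :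
    (Function.update π i (G.deviation P π i t) j).ker t' = (π j).ker t' := by
  by_cases hj : j = i
  · subst hj
    rw [Function.update_self]
    exact Function.update_of_ne h _ _
  · rw [Function.update_of_ne hj]

theorem feedbackLaws_deviation (i : Fin N) (t : ℕ) (x : State m) :
    feedbackLaws (Function.update π i (G.deviation P π i t)) t x =
      Function.update (feedbackLaws π t x) i
        (G.bestResponse P i t x (feedbackLaws π t x)) := by
  funext j
  by_cases hj : j = i
  · subst hj
    simp only [feedbackLaws, Function.update_self, deviation]
    rfl
  · simp only [feedbackLaws, Function.update_of_ne hj]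

theorem liftProfile_update (i : Fin N) (π' : FeedbackPolicy m p) (s : ℕ) :
    liftProfile (Function.update π i π') s = Function.update (liftProfile π s) i (π'.lift s) := by
  funext j
  by_cases hj : j = i
  · subst hj; simp [liftProfile]
  · simp [liftProfile, Function.update_of_ne hj]

/-- If the continuation value is quadratic at almost all successor states, also after a deviation
to a law with a Lebesgue density, then at almost all states reached at time `t` the agents of an
equilibrium play best responses: otherwise deviating at time `t` to the best response would lower
the cost. -/
theorem IsNash.ae_eq_bestResponse {s k t : ℕ} (hst : s + k = t) (ht : t < G.T)
    (hprior : ∀ i x, G.prior i t x = stdGaussian (Control p))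
    (hN : G.IsNash s (liftProfile π s)) (x₀ : State m) (hP : ∀ i, (P i (t + 1)).PosSemidef)
    (hq : ∀ i, 0 ≤ q i (t + 1))
    (hV : ∀ᵐ h ∂(G.law s (liftProfile π s) x₀ k), ∀ i, ∀ μ : Measure (Control p),
      IsProbabilityMeasure μ → μ = (π i).ker t h.cur ∨ μ ≪ volume →
      ∀ᵐ y ∂(G.next t h.cur (Function.update (feedbackLaws π t h.cur) i μ)),
        G.cost i (t + 1) (liftProfile π (t + 1)) y = quadValue P q i (t + 1) y) :
    ∀ᵐ h ∂(G.law s (liftProfile π s) x₀ k), ∀ i,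
      (π i).ker t h.cur = G.bestResponse P i t h.cur (feedbackLaws π t h.cur) ∧
      G.cost i t (liftProfile π t) h.cur =
        ENNReal.ofReal (G.minCost P q i t h.cur (feedbackLaws π t h.cur)) := by
  subst hst
  rw [ae_all_iff]
  intro i
  set π' := Function.update π i (G.deviation P π i (s + k)) with hπ'
  obtain ⟨hfin, hopt⟩ := hN x₀ i
  have hdev := hopt ((G.deviation P π i (s + k)).lift s)
  rw [← liftProfile_update, ← hπ'] at hdev
  have hlaw (l : ℕ) (hl : l ≤ k) :
      G.law s (liftProfile π' s) x₀ l = G.law s (liftProfile π s) x₀ l :=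
    G.law_congr x₀ l fun j l' hl' => deviation_ker_of_ne i j (by omega)
  have hnext : liftProfile π' (s + k + 1) = liftProfile π (s + k + 1) :=
    liftProfile_congr fun j l => deviation_ker_of_ne i j (by omega)
  rw [G.cost_feedback_split π i s k (by omega) x₀] at hfin hdev
  rw [G.cost_feedback_split π' i s k (by omega) x₀, hlaw k le_rfl] at hdev
  have hsum : ∑ l ∈ Finset.range k,
      ∫⁻ h, G.stage i (s + l) h.cur (feedbackLaws π' (s + l) h.cur i)
        ∂(G.law s (liftProfile π' s) x₀ l) = ∑ l ∈ Finset.range k,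
      ∫⁻ h, G.stage i (s + l) h.cur (feedbackLaws π (s + l) h.cur i)
        ∂(G.law s (liftProfile π s) x₀ l) := by
    refine Finset.sum_congr rfl fun l hl => ?_
    have hl := Finset.mem_range.1 hl
    rw [hlaw l hl.le]
    refine lintegral_congr fun h => ?_
    simp only [feedbackLaws, hπ', deviation_ker_of_ne i i (show s + l ≠ s + k by omega)]
  rw [hsum] at hdev
  obtain ⟨hA, hI⟩ := ENNReal.add_ne_top.1 hfin
  have hle := (ENNReal.add_le_add_iff_left hA).1 hdev
  have hcur := Hist.measurable_cur (X := State m) (U := Fin N → Control p) k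
  have hm : Measurable fun h : Hist (State m) (Fin N → Control p) k =>
      G.cost i (s + k) (liftProfile π (s + k)) h.cur := (G.measurable_cost_feedback π i _).comp hcur
  have key : ∀ᵐ h ∂(G.law s (liftProfile π s) x₀ k),
      G.cost i (s + k) (liftProfile π (s + k)) h.cur = ENNReal.ofReal G.τ *
        InformationTheory.klDiv ((π i).ker (s + k) h.cur)
          (G.bestResponse P i (s + k) h.cur (feedbackLaws π (s + k) h.cur))
        + ENNReal.ofReal (G.minCost P q i (s + k) h.cur (feedbackLaws π (s + k) h.cur)) ∧
      G.cost i (s + k) (liftProfile π' (s + k)) h.cur =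
        ENNReal.ofReal (G.minCost P q i (s + k) h.cur (feedbackLaws π (s + k) h.cur)) := by
    filter_upwards [ae_lt_top hm hI, hV] with h hlt hVh
    -- the continuation value may be replaced by the quadratic one, for `π` and for the deviation
    have h1 : G.cost i (s + k) (liftProfile π (s + k)) h.cur =
        G.stage i (s + k) h.cur (feedbackLaws π (s + k) h.cur i)
          + ∫⁻ y, quadValue P q i (s + k + 1) y ∂(G.next (s + k) h.cur
            (Function.update (feedbackLaws π (s + k) h.cur) i
              (feedbackLaws π (s + k) h.cur i))) := by
      have := hVh i (feedbackLaws π (s + k) h.cur i) inferInstance (Or.inl rfl)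
      rw [G.cost_feedback_step π i ht, ← lintegral_congr_ae this, Function.update_eq_self]
    have hne := hlt.ne
    rw [h1] at hne
    obtain ⟨g1, g2⟩ := stage_add_next_eq_klDiv (G := G) (x := h.cur) ht (hprior i h.cur) (hP i)
      (hq i) (memLp_rest_of_ne_top (hP i) (hq i) (ENNReal.add_ne_top.1 hne).2)
    refine ⟨h1.trans (g1 _ inferInstance hne), ?_⟩
    have hac : G.bestResponse P i (s + k) h.cur (feedbackLaws π (s + k) h.cur) ≪ volume :=
      multivariateGaussian_absolutelyContinuous
        ((weight_posSemidef ht (hP i)).smul (by have := G.τ_pos; positivity)) _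
    have := hVh i _ inferInstance (Or.inr hac)
    rw [G.cost_feedback_step π' i ht, hnext, feedbackLaws_deviation, Function.update_self,
      lintegral_congr_ae this]
    exact g2
  -- the deviation never costs more, so optimality of `π` on average forces equality almost surely
  have hle' : (fun h : Hist (State m) (Fin N → Control p) k =>
      G.cost i (s + k) (liftProfile π' (s + k)) h.cur) ≤ᵐ[G.law s (liftProfile π s) x₀ k]
      fun h => G.cost i (s + k) (liftProfile π (s + k)) h.cur := by
    filter_upwards [key] with h hk
    rw [hk.1, hk.2]
    exact le_add_self
  have heq := ae_eq_of_ae_le_of_lintegral_le hle'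
    (ne_top_of_le_ne_top hI (lintegral_mono_ae hle')) hm.aemeasurable hle
  filter_upwards [key, heq] with h hk he
  rw [hk.1, hk.2] at he
  have h0 : ENNReal.ofReal G.τ * InformationTheory.klDiv ((π i).ker (s + k) h.cur)
      (G.bestResponse P i (s + k) h.cur (feedbackLaws π (s + k) h.cur)) = 0 := by
    refine (ENNReal.add_left_inj (ENNReal.ofReal_ne_top (r := G.minCost P q i (s + k) h.cur
      (feedbackLaws π (s + k) h.cur)))).1 ?_
    rw [zero_add, ← he]
  have := (π i).markov (s + k)
  refine ⟨InformationTheory.klDiv_eq_zero_iff.1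
    ((mul_eq_zero.1 h0).resolve_left (by simpa using G.τ_pos)), ?_⟩
  rw [hk.1, h0, zero_add]

/-! ### The linear system for the gains -/

/-- The equations satisfied by the means of mutual best responses in the state `x`. -/
def IsMeanSolution (G : LQGame N m p) (P : Fin N → ℕ → Matrix (Fin m) (Fin m) ℝ) (t : ℕ)
    (x : State m) (u : Fin N → Control p) : Prop :=
  ∀ i, (G.regWeight P i t) *ᵥ (u i).ofLp =
    -(((G.B i t)ᵀ * P i (t + 1)) *ᵥ (G.rest i t x (u, 0)).ofLp)

/-- Mutual best responses are Gaussian, with the covariances `nashCov`; only their means are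
determined by a linear system. -/
theorem isMeanSolution_of_bestResponse {t : ℕ} (ht : t < G.T) (hP : ∀ i, (P i (t + 1)).PosSemidef)
    {x : State m} (h : ∀ i, (π i).ker t x = G.bestResponse P i t x (feedbackLaws π t x)) :
    ∃ u : Fin N → Control p, G.IsMeanSolution P t x u ∧
      ∀ i, (π i).ker t x = multivariateGaussian (u i) (G.nashCov P i t) := by
  refine ⟨fun i => G.bestMean P i t x (feedbackLaws π t x), fun i => ?_, h⟩
  have hlaws : feedbackLaws π t x = fun j =>
      multivariateGaussian (G.bestMean P j t x (feedbackLaws π t x)) (G.nashCov P j t) := funext h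
  have hD : IsUnit (G.regWeight P i t).det := (regWeight_posDef ht (hP i)).det_pos.ne'.isUnit
  have hlin : G.linCoeff P i t x (feedbackLaws π t x) = ((G.B i t)ᵀ * P i (t + 1)) *ᵥ
      (G.rest i t x ((fun i => G.bestMean P i t x (feedbackLaws π t x)), 0)).ofLp := by
    conv_lhs => rw [hlaws]
    exact linCoeff_of_gaussian _ (hP i)
  rw [← hlin]
  change _ *ᵥ (-((G.regWeight P i t)⁻¹ *ᵥ _)) = _
  rw [Matrix.mulVec_neg, Matrix.mulVec_mulVec, Matrix.mul_nonsing_inv _ hD, Matrix.one_mulVec]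

/-- If the linear means `K x` solve the equations in every state, then the gains solve the gain
equations. -/
theorem gain_of_isMeanSolution {t : ℕ} (ht : t < G.T) (hP : ∀ i, (P i (t + 1)).PosSemidef)
    (h : ∀ x, G.IsMeanSolution P t x fun j => (K j t).toEuclideanLin x) (i : Fin N) :
    K i t = G.gainRhs P K i t := by
  have hD : IsUnit (G.regWeight P i t).det := (regWeight_posDef ht (hP i)).det_pos.ne'.isUnit
  have h1 : G.regWeight P i t * K i t = -((G.B i t)ᵀ * P i (t + 1) * G.othersA K i t) := by
    refine Matrix.ext_of_mulVec_single fun c => ?_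
    have := h (WithLp.toLp 2 (Pi.single c 1)) i
    rw [rest_linear, Matrix.mulVec_mulVec, Matrix.ofLp_toLpLin, Matrix.toLin'_apply,
      Matrix.mulVec_mulVec, ← Matrix.neg_mulVec] at this
    exact this
  rw [gainRhs, ← Matrix.mul_neg, ← h1, ← Matrix.mul_assoc, Matrix.nonsing_inv_mul _ hD,
    Matrix.one_mul]

theorem gainMatrix_mulVec (t : ℕ) (v : Fin N → Fin p → ℝ) (a : Fin N × Fin p) :
    (G.gainMatrix P t *ᵥ fun b => v b.1 b.2) a = (G.regWeight P a.1 t *ᵥ v a.1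
      + ∑ j ∈ Finset.univ.erase a.1, ((G.B a.1 t)ᵀ * P a.1 (t + 1) * G.B j t) *ᵥ v j) a.2 := by
  rw [Matrix.mulVec, dotProduct, Fintype.sum_prod_type,
    ← Finset.add_sum_erase _ _ (Finset.mem_univ a.1), Pi.add_apply, Finset.sum_apply]
  congr 1
  · simp [gainMatrix, Matrix.mulVec, dotProduct]
  · refine Finset.sum_congr rfl fun j hj => ?_
    simp [gainMatrix, Matrix.mulVec, dotProduct, (Finset.ne_of_mem_erase hj).symm]

theorem isMeanSolution_iff (t : ℕ) (x : State m) (u : Fin N → Control p) :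
    G.IsMeanSolution P t x u ↔ (G.gainMatrix P t *ᵥ fun b => (u b.1).ofLp b.2) =
      fun a => -((((G.B a.1 t)ᵀ * P a.1 (t + 1) * G.A t) *ᵥ x.ofLp) a.2) := by
  have hrest (i : Fin N) : ((G.B i t)ᵀ * P i (t + 1)) *ᵥ (G.rest i t x (u, 0)).ofLp =
      ((G.B i t)ᵀ * P i (t + 1) * G.A t) *ᵥ x.ofLp
      + ∑ j ∈ Finset.univ.erase i, ((G.B i t)ᵀ * P i (t + 1) * G.B j t) *ᵥ (u j).ofLp := by
    rw [rest]
    simp only [WithLp.ofLp_add, WithLp.ofLp_sum, Matrix.ofLp_toLpLin, Matrix.toLin'_apply,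
      add_zero, Matrix.mulVec_add, Matrix.mulVec_sum, Matrix.mulVec_mulVec]
  rw [IsMeanSolution, funext_iff, Prod.forall]
  refine forall_congr' fun i => ?_
  rw [funext_iff]
  refine forall_congr' fun a => ?_
  rw [gainMatrix_mulVec t (fun j => (u j).ofLp), hrest]
  simp only [Pi.add_apply, Pi.neg_apply]
  constructor <;> intro h <;> linarith

theorem IsMeanSolution.unique {t : ℕ} {x : State m} (hdet : IsUnit (G.gainMatrix P t).det)
    {u v : Fin N → Control p} (hu : G.IsMeanSolution P t x u) (hv : G.IsMeanSolution P t x v) :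
    u = v := by
  rw [isMeanSolution_iff] at hu hv
  have := Matrix.mulVec_injective_of_isUnit ((Matrix.isUnit_iff_isUnit_det _).2 hdet)
    (hu.trans hv.symm)
  funext i
  ext a
  exact congrFun this (i, a)

/-- The right-hand side of the linear system for the gains, up to sign: its blocks are
`(B^i_t)ᵀ P^i_{t+1} A_t`. -/
def gainRhsMatrix (G : LQGame N m p) (P : Fin N → ℕ → Matrix (Fin m) (Fin m) ℝ) (t : ℕ) :
    Matrix (Fin N × Fin p) (Fin m) ℝ :=
  Matrix.of fun b c => ((G.B b.1 t)ᵀ * P b.1 (t + 1) * G.A t) b.2 c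

/-- The gains solving the linear system with the matrix `gainMatrix`. -/
noncomputable def nashGain (G : LQGame N m p) (P : Fin N → ℕ → Matrix (Fin m) (Fin m) ℝ) (t : ℕ)
    (i : Fin N) : Matrix (Fin p) (Fin m) ℝ :=
  Matrix.of fun a c => (-((G.gainMatrix P t)⁻¹ * G.gainRhsMatrix P t)) (i, a) c

theorem isMeanSolution_nashGain {t : ℕ} (hdet : IsUnit (G.gainMatrix P t).det)
    (hK : ∀ i, K i t = G.nashGain P t i) (x : State m) :
    G.IsMeanSolution P t x fun j => (K j t).toEuclideanLin x := by
  rw [isMeanSolution_iff]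
  have h1 : (fun b : Fin N × Fin p => ((K b.1 t).toEuclideanLin x).ofLp b.2) =
      (-((G.gainMatrix P t)⁻¹ * G.gainRhsMatrix P t)) *ᵥ x.ofLp := by
    funext b
    rw [hK]
    rfl
  rw [h1, Matrix.mulVec_mulVec, Matrix.mul_neg, ← Matrix.mul_assoc, Matrix.mul_nonsing_inv _ hdet,
    Matrix.one_mul, Matrix.neg_mulVec]
  rfl

end LQGame

/-! ### Backward construction of the Riccati matrices -/

theorem exists_backward_recursion {α : Type*} (T : ℕ) (a : α) (F : ℕ → α → α) :
    ∃ f : ℕ → α, f T = a ∧ ∀ t, t < T → f t = F t (f (t + 1)) := by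
  refine ⟨fun t => Nat.rec a (fun k b => F (T - 1 - k) b) (T - t), by simp, fun t ht => ?_⟩
  have h : T - t = T - (t + 1) + 1 := by omega
  simp only [h]
  congr 1
  omega

namespace LQGame

variable {N m p : ℕ} {G : LQGame N m p}
  {P : Fin N → ℕ → Matrix (Fin m) (Fin m) ℝ} {q : Fin N → ℕ → ℝ}
  {K : Fin N → ℕ → Matrix (Fin p) (Fin m) ℝ} {π : Fin N → FeedbackPolicy m p}

/-- The backward recursion for the matrices `P`, with gains prescribed as functions of the matrices
at the next time. -/
theorem exists_riccati (G : LQGame N m p) (κ : ℕ → (Fin N → Matrix (Fin m) (Fin m) ℝ) →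
    Fin N → Matrix (Fin p) (Fin m) ℝ) :
    ∃ (P : Fin N → ℕ → Matrix (Fin m) (Fin m) ℝ) (K : Fin N → ℕ → Matrix (Fin p) (Fin m) ℝ),
      (∀ i, P i G.T = G.Q i G.T) ∧ (∀ i t, t < G.T → P i t = G.riccatiRhs P K i t) ∧
      ∀ i t, K i t = κ t (fun j => P j (t + 1)) i := by
  obtain ⟨f, hf, hstep⟩ := exists_backward_recursion G.T (fun i => G.Q i G.T)
    fun t P' i => G.riccatiRhs (fun j _ => P' j) (fun j _ => κ t P' j) i t
  refine ⟨fun i t => f t i, fun i t => κ t (f (t + 1)) i, fun i => congrFun hf i,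
    fun i t ht => congrFun (hstep t ht) i, fun i t => rfl⟩

theorem exists_offset (G : LQGame N m p) (P : Fin N → ℕ → Matrix (Fin m) (Fin m) ℝ) :
    ∃ q : Fin N → ℕ → ℝ, G.IsOffset P q := by
  refine ⟨fun i t => ∑ t' ∈ Finset.Ico t G.T, G.offsetStep P i t', fun i => by simp,
    fun i t ht => ?_⟩
  rw [Finset.sum_eq_sum_Ico_succ_bot ht, offsetStep]
  ring

theorem IsRiccatiFrom.of_succ {t : ℕ} (h : G.IsRiccatiFrom (t + 1) P K)
    (hK : ∀ i, K i t = G.gainRhs P K i t) (hP : ∀ i, P i t = G.riccatiRhs P K i t) :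
    G.IsRiccatiFrom t P K where
  terminal := h.terminal
  gain i t' h1 h2 := by
    rcases h1.eq_or_lt with rfl | h1
    · exact hK i
    · exact h.gain i t' h1 h2
  riccati i t' h1 h2 := by
    rcases h1.eq_or_lt with rfl | h1
    · exact hP i
    · exact h.riccati i t' h1 h2

theorem isRiccatiFrom_terminal (h : ∀ i, P i G.T = G.Q i G.T) : G.IsRiccatiFrom G.T P K where
  terminal := h
  gain _ _ h1 h2 := absurd h1 (by omega)
  riccati _ _ h1 h2 := absurd h1 (by omega)

/-- In a nonsingular game the gains can be computed backwards in time from the linear systems. -/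
theorem isRiccatiFrom_of_nashGain (hG : G.IsNonsingular) (hT : ∀ i, P i G.T = G.Q i G.T)
    (hP : ∀ i t, t < G.T → P i t = G.riccatiRhs P K i t) (hK : ∀ i t, K i t = G.nashGain P t i)
    {t : ℕ} (ht : t ≤ G.T) : G.IsRiccatiFrom t P K := by
  induction ht using Nat.decreasingInduction with
  | self => exact isRiccatiFrom_terminal hT
  | of_succ t ht ih =>
    exact ih.of_succ (gain_of_isMeanSolution ht (fun i => ih.posSemidef le_rfl ht i)
      (isMeanSolution_nashGain (hG t ht P K ih) fun i => hK i t)) fun i => hP i t ht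

/-! ### Equilibria are linear Gaussian -/

/-- If the only means consistent with mutual best responses are the linear ones `K x`, then mutual
best responses are linear Gaussian, and the cost takes the quadratic form given by the Riccati
equation. -/
theorem isLinGaussAt_of_bestResponse {t : ℕ} (ht : t < G.T) (hP : ∀ i, (P i (t + 1)).PosSemidef)
    (hPt : ∀ i, P i t = G.riccatiRhs P K i t)
    (hqt : ∀ i, q i t = q i (t + 1) + G.offsetStep P i t) {x : State m}
    (h : ∀ i, (π i).ker t x = G.bestResponse P i t x (feedbackLaws π t x) ∧
      G.cost i t (liftProfile π t) x =
        ENNReal.ofReal (G.minCost P q i t x (feedbackLaws π t x)))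
    (hu : ∀ u, G.IsMeanSolution P t x u →
      (∀ i, (π i).ker t x = multivariateGaussian (u i) (G.nashCov P i t)) →
      u = fun j => (K j t).toEuclideanLin x) :
    G.IsLinGaussAt P K π t x ∧
      ∀ i, G.cost i t (liftProfile π t) x = quadValue P q i t x := by
  obtain ⟨u, hmean, hker⟩ := isMeanSolution_of_bestResponse ht hP fun i => (h i).1
  obtain rfl := hu u hmean hker
  refine ⟨hker, fun i => ?_⟩
  have hlaws : feedbackLaws π t x = fun j =>
      multivariateGaussian ((K j t).toEuclideanLin x) (G.nashCov P j t) := funext hker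
  rw [(h i).2, hlaws, minCost_of_gaussian ht hP (hPt i) (hqt i), quadValue]

/-- At an equilibrium of the game started at time `t`, whose continuation costs are quadratic, the
agents play mutual best responses in every state. -/
theorem IsNash.eq_bestResponse {t : ℕ} (ht : t < G.T)
    (hprior : ∀ i x, G.prior i t x = stdGaussian (Control p))
    (hN : G.IsNash t (liftProfile π t)) (hP : ∀ i, (P i (t + 1)).PosSemidef)
    (hq : ∀ i, 0 ≤ q i (t + 1))
    (hV : ∀ i y, G.cost i (t + 1) (liftProfile π (t + 1)) y = quadValue P q i (t + 1) y)
    (x : State m) (i : Fin N) :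
    (π i).ker t x = G.bestResponse P i t x (feedbackLaws π t x) ∧
      G.cost i t (liftProfile π t) x =
        ENNReal.ofReal (G.minCost P q i t x (feedbackLaws π t x)) := by
  have h := hN.ae_eq_bestResponse (k := 0) rfl ht hprior x hP hq
    (Filter.Eventually.of_forall fun h i μ _ _ => Filter.Eventually.of_forall (hV i))
  change ∀ᵐ y ∂(Measure.dirac x : Measure (State m)), ∀ i,
    (π i).ker t y = G.bestResponse P i t y (feedbackLaws π t y) ∧
      G.cost i t (liftProfile π t) y =
        ENNReal.ofReal (G.minCost P q i t y (feedbackLaws π t y)) at h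
  rw [ae_dirac_eq] at h
  exact h i

/-- If the matrix of the linear system is invertible, the means of mutual best responses are
`K x`. -/
theorem eq_of_isMeanSolution_of_isNonsingular (hG : G.IsNonsingular)
    (hK : ∀ i t, K i t = G.nashGain P t i) {t : ℕ} (ht : t < G.T)
    (hR : G.IsRiccatiFrom (t + 1) P K) (x : State m) (u : Fin N → Control p)
    (hu : G.IsMeanSolution P t x u) : u = fun j => (K j t).toEuclideanLin x :=
  hu.unique (hG t ht P K hR) (isMeanSolution_nashGain (hG t ht P K hR) (fun i => hK i t) x)

variable (hprior : ∀ i t, t < G.T → ∀ x, G.prior i t x = stdGaussian (Control p))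

include hprior

/-- The backward induction for an equilibrium at all times. The hypothesis `hgain` says that, once
the Riccati equations hold after time `t`, the means of mutual best responses at time `t` are given
by the gains `K`. -/
theorem isRiccatiFrom_of_isNash (hN : ∀ s, s ≤ G.T → G.IsNash s (liftProfile π s))
    (hT : ∀ i, P i G.T = G.Q i G.T) (hP : ∀ i t, t < G.T → P i t = G.riccatiRhs P K i t)
    (hq : G.IsOffset P q)
    (hgain : ∀ t, t < G.T → G.IsRiccatiFrom (t + 1) P K → ∀ x u, G.IsMeanSolution P t x u →
      (∀ i, (π i).ker t x = multivariateGaussian (u i) (G.nashCov P i t)) →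
      u = fun j => (K j t).toEuclideanLin x)
    {t : ℕ} (ht : t ≤ G.T) :
    G.IsRiccatiFrom t P K ∧ (∀ i x, G.cost i t (liftProfile π t) x = quadValue P q i t x) ∧
      (t < G.T → ∀ x, G.IsLinGaussAt P K π t x) := by
  induction ht using Nat.decreasingInduction with
  | self =>
    refine ⟨isRiccatiFrom_terminal hT, fun i x => ?_, fun h => absurd h (lt_irrefl _)⟩
    rw [cost_feedback_terminal, quadValue, hT, hq.terminal, add_zero]
  | of_succ t ht ih =>
    obtain ⟨hR, hV, -⟩ := ih
    have hPs (i : Fin N) := hR.posSemidef le_rfl ht i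
    have hbest := (hN t ht.le).eq_bestResponse ht (fun i x => hprior i t ht x) hPs
      (fun i => hR.offset_nonneg hq le_rfl ht i) hV
    have hlin (x : State m) := isLinGaussAt_of_bestResponse (K := K) ht hPs (fun i => hP i t ht)
      (fun i => hq.step_eq i ht) (hbest x) (hgain t ht hR x)
    have hmean (x : State m) : G.IsMeanSolution P t x fun j => (K j t).toEuclideanLin x := by
      obtain ⟨u, hu, hker⟩ := isMeanSolution_of_bestResponse ht hPs fun i => (hbest x i).1
      exact hgain t ht hR x u hu hker ▸ hu
    exact ⟨hR.of_succ (gain_of_isMeanSolution ht hPs hmean) fun i => hP i t ht,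
      fun i x => (hlin x).2 i, fun _ x => (hlin x).1⟩

/-- The backward induction for a full-support equilibrium of the game started at time zero. A
deviation with a Lebesgue density is absolutely continuous with respect to the equilibrium policy,
so the states that are negligible under the equilibrium stay negligible after the deviation. -/
theorem ae_isLinGaussAt_of_isNash
    (hsupp : ∀ i t, t < G.T → ∀ x, (volume : Measure (Control p)) ≪ (π i).ker t x)
    (hN : G.IsNash 0 (liftProfile π 0)) (hG : G.IsNonsingular)
    (hR : G.IsRiccatiFrom 0 P K) (hK : ∀ i t, K i t = G.nashGain P t i) (hq : G.IsOffset P q)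
    {t : ℕ} (ht : t ≤ G.T) (x₀ : State m) :
    (∀ᵐ h ∂(G.law 0 (liftProfile π 0) x₀ t), t < G.T → G.IsLinGaussAt P K π t h.cur) ∧
      ∀ᵐ h ∂(G.law 0 (liftProfile π 0) x₀ t),
        ∀ i, G.cost i t (liftProfile π t) h.cur = quadValue P q i t h.cur := by
  induction ht using Nat.decreasingInduction with
  | self =>
    refine ⟨Filter.Eventually.of_forall fun _ h => absurd h (lt_irrefl _),
      Filter.Eventually.of_forall fun h i => ?_⟩
    rw [cost_feedback_terminal, quadValue, hR.terminal, hq.terminal, add_zero]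
  | of_succ t ht ih =>
    have hPs (i : Fin N) := hR.posSemidef (by omega) ht i
    set good : Set (State m) := {y | ∀ i, G.cost i (t + 1) (liftProfile π (t + 1)) y =
      quadValue P q i (t + 1) y} with hgood
    have hmeas : MeasurableSet goodᶜ := by
      refine MeasurableSet.compl ?_
      rw [hgood, Set.ofPred_forall]
      exact MeasurableSet.iInter fun i => measurableSet_eq_fun (G.measurable_cost_feedback π i _)
        (measurable_quadValue P q i _)
    have hzero : ∀ᵐ h ∂(G.law 0 (liftProfile π 0) x₀ t),
        G.next t h.cur (feedbackLaws π t h.cur) goodᶜ = 0 := by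
      -- the bad set is negligible at time `t + 1`: condition on the history up to time `t`
      have h0 : ∫⁻ h, goodᶜ.indicator 1 h.cur ∂(G.law 0 (liftProfile π 0) x₀ (t + 1)) = 0 := by
        refine (lintegral_congr_ae ?_).trans lintegral_zero
        filter_upwards [ih.2] with h hh
        have hh : h.cur ∈ good := hh
        exact Set.indicator_of_notMem (Set.notMem_compl_iff.2 hh) _
      rw [G.lintegral_law_feedback_succ π 0 x₀ t (measurable_one.indicator hmeas), zero_add] at h0
      have hm : Measurable fun h : Hist (State m) (Fin N → Control p) t =>
          ∫⁻ y, goodᶜ.indicator 1 y ∂(G.next t h.cur (feedbackLaws π t h.cur)) :=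
        (G.measurable_lintegral_next_feedback π t (measurable_one.indicator hmeas)).comp
          (Hist.measurable_cur t)
      filter_upwards [(lintegral_eq_zero_iff hm).1 h0] with h hh
      rwa [lintegral_indicator_one hmeas] at hh
    have hbest := hN.ae_eq_bestResponse (zero_add t) ht (fun i x => hprior i t ht x) x₀ hPs
      (fun i => hR.offset_nonneg hq (by omega) ht i) (by
        filter_upwards [hzero] with h hh i μ hμ hor
        have hac : μ ≪ feedbackLaws π t h.cur i := by
          rcases hor with rfl | hor
          · exact Measure.AbsolutelyContinuous.rfl
          · exact hor.trans (hsupp i t ht h.cur)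
        have := (G.next_update_absolutelyContinuous t h.cur _ i μ hac) hh
        filter_upwards [measure_eq_zero_iff_ae_notMem.1 this] with y hy
        exact Set.notMem_compl_iff.1 hy i)
    have hlin : ∀ᵐ h ∂(G.law 0 (liftProfile π 0) x₀ t), G.IsLinGaussAt P K π t h.cur ∧
        ∀ i, G.cost i t (liftProfile π t) h.cur = quadValue P q i t h.cur := by
      have hR' : G.IsRiccatiFrom (t + 1) P K :=
        ⟨hR.terminal, fun i t' _ => hR.gain i t' (by omega), fun i t' _ =>
          hR.riccati i t' (by omega)⟩
      filter_upwards [hbest] with h hh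
      exact isLinGaussAt_of_bestResponse ht hPs (fun i => hR.riccati i t (by omega) ht)
        (fun i => hq.step_eq i ht) hh
        fun u hu _ => eq_of_isMeanSolution_of_isNonsingular hG hK ht hR' _ u hu
    exact ⟨hlin.mono fun h hh _ => hh.1, hlin.mono fun h hh => hh.2⟩

end LQGame

theorem mainTheorem1 {N m p : ℕ} (G : LQGame N m p)
    (hprior : ∀ i t, t < G.T → ∀ x, G.prior i t x = stdGaussian (Control p)) :
    -- every solution of the coupled Riccati equations gives a linear Gaussian equilibrium
    (∀ (P : Fin N → ℕ → Matrix (Fin m) (Fin m) ℝ)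
        (K : Fin N → ℕ → Matrix (Fin p) (Fin m) ℝ) (q : Fin N → ℕ → ℝ),
      G.IsRiccatiFrom 0 P K → G.IsOffset P q →
      (∀ i t, t ≤ G.T → (P i t).PosSemidef) ∧
      (∀ s, s ≤ G.T → G.IsNash s (liftProfile (G.gaussPolicy P K) s)) ∧
      (∀ t, t ≤ G.T → ∀ x, G.HasQuadValue P q (G.gaussPolicy P K) t x)) ∧
    -- an equilibrium for all initial times and states is linear Gaussian, with quadratic values
    (∀ π : Fin N → FeedbackPolicy m p,
      (∀ s, s ≤ G.T → G.IsNash s (liftProfile π s)) →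
      (G.IsNonsingular ∨ G.HasLinearMeans π) →
      ∃ (P : Fin N → ℕ → Matrix (Fin m) (Fin m) ℝ)
        (K : Fin N → ℕ → Matrix (Fin p) (Fin m) ℝ) (q : Fin N → ℕ → ℝ),
        G.IsRiccatiFrom 0 P K ∧ G.IsOffset P q ∧
        (∀ i t, t ≤ G.T → (P i t).PosSemidef) ∧
        (∀ t, t < G.T → ∀ x, G.IsLinGaussAt P K π t x) ∧
        (∀ t, t ≤ G.T → ∀ x, G.HasQuadValue P q π t x)) ∧
    -- an equilibrium for the initial time zero has the same form at almost all reached states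
    (∀ π : Fin N → FeedbackPolicy m p,
      (∀ i t, t < G.T → ∀ x, (volume : Measure (Control p)) ≪ (π i).ker t x) →
      G.IsNash 0 (liftProfile π 0) →
      G.IsNonsingular →
      ∃ (P : Fin N → ℕ → Matrix (Fin m) (Fin m) ℝ)
        (K : Fin N → ℕ → Matrix (Fin p) (Fin m) ℝ) (q : Fin N → ℕ → ℝ),
        G.IsRiccatiFrom 0 P K ∧ G.IsOffset P q ∧
        (∀ i t, t ≤ G.T → (P i t).PosSemidef) ∧
        (∀ x₀, ∀ t, t < G.T → ∀ᵐ h ∂(G.law 0 (liftProfile π 0) x₀ t),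
          G.IsLinGaussAt P K π t h.cur) ∧
        (∀ x₀, ∀ t, t ≤ G.T → ∀ᵐ h ∂(G.law 0 (liftProfile π 0) x₀ t),
          G.HasQuadValue P q π t h.cur)) := by
  refine ⟨fun P K q hR hq => ?_, fun π hN hcases => ?_, fun π hsupp hN hG => ?_⟩
  · have hP (i : Fin N) (t : ℕ) (ht : t ≤ G.T) := hR.posSemidef (Nat.zero_le t) ht i
    exact ⟨hP, fun s hs => LQGame.isNash_gaussPolicy hprior hR hq hs, fun t ht x =>
      LQGame.hasQuadValue_of_cost_eq (fun i => hP i t ht)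
        (fun i => hR.offset_nonneg hq (Nat.zero_le t) ht i)
        fun i => LQGame.cost_gaussPolicy hprior hR hq i ht x⟩
  · -- the gains are prescribed, either by the linear systems or by the means of the equilibrium
    obtain ⟨P, K, hT, hP, hgain⟩ : ∃ (P : Fin N → ℕ → Matrix (Fin m) (Fin m) ℝ)
        (K : Fin N → ℕ → Matrix (Fin p) (Fin m) ℝ), (∀ i, P i G.T = G.Q i G.T) ∧
        (∀ i t, t < G.T → P i t = G.riccatiRhs P K i t) ∧
        ∀ t, t < G.T → G.IsRiccatiFrom (t + 1) P K → ∀ x u, G.IsMeanSolution P t x u →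
          (∀ i, (π i).ker t x = multivariateGaussian (u i) (G.nashCov P i t)) →
          u = fun j => (K j t).toEuclideanLin x := by
      rcases hcases with hG | hL
      · obtain ⟨P, K, hT, hP, hK⟩ := G.exists_riccati fun t P' i => G.nashGain (fun j _ => P' j) t i
        exact ⟨P, K, hT, hP, fun t ht hR x u hu _ =>
          LQGame.eq_of_isMeanSolution_of_isNonsingular hG (fun i t => hK i t) ht hR x u hu⟩
      · choose L hL using hL
        obtain ⟨P, K, hT, hP, hK⟩ := G.exists_riccati fun t _ i =>
          if h : t < G.T then L i t h else 0
        refine ⟨P, K, hT, hP, fun t ht _ x u _ hker => funext fun i => ?_⟩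
        rw [hK, dif_pos ht, ← hL i t ht x, hker i, integral_id_multivariateGaussian]
    obtain ⟨q, hq⟩ := G.exists_offset P
    have key (t : ℕ) (ht : t ≤ G.T) :=
      LQGame.isRiccatiFrom_of_isNash hprior hN hT hP hq hgain ht
    have hR := (key 0 (Nat.zero_le _)).1
    have hpos (i : Fin N) (t : ℕ) (ht : t ≤ G.T) := hR.posSemidef (Nat.zero_le t) ht i
    exact ⟨P, K, q, hR, hq, hpos, fun t ht => (key t ht.le).2.2 ht, fun t ht x =>
      LQGame.hasQuadValue_of_cost_eq (fun i => hpos i t ht)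
        (fun i => hR.offset_nonneg hq (Nat.zero_le t) ht i) fun i => (key t ht).2.1 i x⟩
  · obtain ⟨P, K, hT, hP, hK⟩ := G.exists_riccati fun t P' i => G.nashGain (fun j _ => P' j) t i
    obtain ⟨q, hq⟩ := G.exists_offset P
    have hR : G.IsRiccatiFrom 0 P K :=
      LQGame.isRiccatiFrom_of_nashGain hG hT hP (fun i t => hK i t) (Nat.zero_le _)
    have hpos (i : Fin N) (t : ℕ) (ht : t ≤ G.T) := hR.posSemidef (Nat.zero_le t) ht i
    have key {t : ℕ} (ht : t ≤ G.T) (x₀ : State m) :=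
      LQGame.ae_isLinGaussAt_of_isNash hprior hsupp hN hG hR (fun i t => hK i t) hq ht x₀
    refine ⟨P, K, q, hR, hq, hpos, fun x₀ t ht => ?_, fun x₀ t ht => ?_⟩
    · exact (key ht.le x₀).1.mono fun h hh => hh ht
    · exact (key ht x₀).2.mono fun h hh => LQGame.hasQuadValue_of_cost_eq
        (fun i => hpos i t ht) (fun i => hR.offset_nonneg hq (Nat.zero_le t) ht i) hh
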